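/- Let $(M,g)$ be a compact connected smooth Riemannian manifold (without boundary), let $V\colon M\to\mathbb R$ be smooth, and let $H(x,\xi)=\tfrac12|\xi|_g^2+V(x)$ on the cotangent bundle $\pi\colon T^*M\to M$ with its canonical symplectic form $\omega=\sum_j dx_j\wedge d\xi_j$. A classical path in time $t>0$ is an integral curve $\gamma=(x(s),\xi(s))\colon[0,t]\to T^*M$ of the Hamilton vector field $X_H$, defined by $\omega(X_H,\cdot)=dH$. For $x,y\in M$ let $\Gamma_{t,x,y}$ be the set of classical paths $\gamma$ in time $t$ with $\pi(\gamma(0))=y$ and $\pi(\gamma(t))=x$, and for $\nu\in\mathbb R$ let $\Gamma_{t,x,y}(\nu)$ be the set of those with $|\xi(0)|_g<\nu$. **Theorem.** There exist $t_0>0$, an open neighborhood $N\subset M\times M$ of the diagonal and $\mu>0$ such that the following holds. 1. For all $(x,y)\in N$ and $t\in(0,t_0)$ the set $\Gamma_{t,x,y}(\mu/t)$ has exactly one element $\gamma^t(x,y)=(x^t_s(x,y),\xi^t_s(x,y))_{0\le s\le t}$. 2. This path is the lowest-energy path: every other $(q,p)\in\Gamma_{t,x,y}$ satisfies $|p(0)|_g>|\xi^t_0(x,y)|_g$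 and $H(q(0),p(0))>H(x^t_0(x,y),\xi^t_0(x,y))$. 3. The map $(t,x,y,s)\mapsto(x^t_s(x,y),\xi^t_s(x,y))\in T^*M$ is smooth on $\{(t,x,y,s): 0<t<t_0,\ (x,y)\in N,\ 0\le s\le t\}$. 4. For all $(x,y)\in N$ and $t\in(0,t_0)$ the integrand of the action $$S(t,x,y)=\int_0^t\Big(\tfrac12\Big|\frac{d}{ds}x^t_s(x,y)\Big|_g^2-V(x^t_s(x,y))\Big)\,ds$$ is integrable, and $S$ is a smooth function on $(0,t_0)\times N$. -/

import Mathlib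

open Set Bundle Manifold MeasureTheory
open scoped ContDiff Topology

noncomputable section

namespace LowEnergy

/-- The fibre `T*_x M` of the cotangent bundle: continuous linear forms on `T_x M`. For a Riemannian
metric on `M`, the operator norm on this fibre is the dual norm `|ξ|_g`. -/
abbrev CotangentFiber (E : Type*) [NormedAddCommGroup E] [NormedSpace ℝ E]
    (M : Type*) [TopologicalSpace M] [ChartedSpace E M] (x : M) : Type _ :=
  TangentSpace 𝓘(ℝ, E) x →L[ℝ] Trivial M ℝ x

/-- The cotangent bundle `T*M`, with the topology and the smooth structure of the bundle of
continuous linear maps from the tangent bundle to the trivial line bundle. -/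
abbrev CotangentBundle (E : Type*) [NormedAddCommGroup E] [NormedSpace ℝ E]
    (M : Type*) [TopologicalSpace M] [ChartedSpace E M] : Type _ :=
  TotalSpace (E →L[ℝ] ℝ) (CotangentFiber E M)

variable {E : Type*} [NormedAddCommGroup E] [NormedSpace ℝ E]
  {M : Type*} [TopologicalSpace M] [ChartedSpace E M] [IsManifold 𝓘(ℝ, E) ∞ M]

/-- The model with corners of `T*M`. -/
abbrev cotangentModel (E : Type*) [NormedAddCommGroup E] [NormedSpace ℝ E] :
    ModelWithCorners ℝ (E × (E →L[ℝ] ℝ)) (ModelProd E (E →L[ℝ] ℝ)) :=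
  𝓘(ℝ, E).prod 𝓘(ℝ, E →L[ℝ] ℝ)

/-- The canonical symplectic form `ω = ∑ dx_j ∧ dξ_j` of `T*M` at `p = (x, ξ)`. The preferred chart
of `T*M` at `p` is the canonical chart `(x_j, ξ_j)` induced by the preferred chart `(x_j)` of `M`
at `x`, and Mathlib identifies `T_p T*M` with `E × E*` through the differential of that chart:
a tangent vector is the pair of its position and its momentum components. -/
def symplecticForm (p : CotangentBundle E M) (v w : TangentSpace (cotangentModel E) p) : ℝ :=
  let v' : E × (E →L[ℝ] ℝ) := v
  let w' : E × (E →L[ℝ] ℝ) := w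
  w'.2 v'.1 - v'.2 w'.1

/-- `v` is the value at `p` of the Hamilton vector field of `H`, i.e. `ω_p(v, ·) = dH_p`; in
canonical coordinates `v = ∑ (∂H/∂ξ_j) ∂_{x_j} - (∂H/∂x_j) ∂_{ξ_j}`. -/
def IsHamiltonVectorAt (H : CotangentBundle E M → ℝ) (p : CotangentBundle E M)
    (v : TangentSpace (cotangentModel E) p) : Prop :=
  ∀ w : TangentSpace (cotangentModel E) p,
    symplecticForm p v w = mfderiv (cotangentModel E) 𝓘(ℝ, ℝ) H p w

/-- The restriction of `γ` to `[0, t]` is a classical path (an integral curve of the Hamilton vector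
field) for the Hamiltonian `H`. Only the values of `γ` on `[0, t]` matter. -/
def IsClassicalPath (H : CotangentBundle E M → ℝ) (t : ℝ) (γ : ℝ → CotangentBundle E M) : Prop :=
  ∀ s ∈ Icc (0 : ℝ) t, ∃ v : TangentSpace (cotangentModel E) (γ s),
    HasMFDerivWithinAt 𝓘(ℝ, ℝ) (cotangentModel E) γ (Icc 0 t) s
      (ContinuousLinearMap.toSpanSingleton ℝ v) ∧
    IsHamiltonVectorAt H (γ s) v

/-- `Γ^H_{t,x,y}`: the classical paths for `H` from `y` to `x` in time `t`. A path on `[0, t]` is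
represented by the maps on `ℝ` that extend it. -/
def classicalPaths (H : CotangentBundle E M → ℝ) (t : ℝ) (x y : M) :
    Set (ℝ → CotangentBundle E M) :=
  {γ | IsClassicalPath H t γ ∧ (γ 0).proj = y ∧ (γ t).proj = x}

variable [RiemannianBundle (fun x : M ↦ TangentSpace 𝓘(ℝ, E) x)]

/-- `|ξ|_g` for `p = (x, ξ) ∈ T*M`. -/
def momentumNorm (p : CotangentBundle E M) : ℝ := ‖p.2‖

/-- The Hamiltonian `H(x, ξ) = |ξ|_g² / 2 + V(x)`. -/
def hamiltonian (V : M → ℝ) (p : CotangentBundle E M) : ℝ :=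
  (1 / 2) * momentumNorm p ^ 2 + V p.proj

/-- `Γ^H_{t,x,y}(μ)`: the paths in `Γ^H_{t,x,y}` whose initial momentum has norm `< μ`. -/
def lowClassicalPaths (H : CotangentBundle E M → ℝ) (t : ℝ) (x y : M) (μ : ℝ) :
    Set (ℝ → CotangentBundle E M) :=
  {γ ∈ classicalPaths H t x y | momentumNorm (γ 0) < μ}

/-- The Lagrangian `|x'(s)|_g² / 2 - V(x(s))` along the projection `x(s)` to `M` of the path `γ` on
`[0, t]`. -/
def lagrangianAlong (V : M → ℝ) (t : ℝ) (γ : ℝ → CotangentBundle E M) (s : ℝ) : ℝ :=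
  (1 / 2) * ‖(mfderivWithin 𝓘(ℝ, ℝ) 𝓘(ℝ, E) (fun r ↦ (γ r).proj) (Icc 0 t) s (1 : ℝ) :
    TangentSpace 𝓘(ℝ, E) (γ s).proj)‖ ^ 2 - V (γ s).proj

/-- The action integral of the path `γ` on `[0, t]`. -/
def action (V : M → ℝ) (t : ℝ) (γ : ℝ → CotangentBundle E M) : ℝ :=
  ∫ s in (0 : ℝ)..t, lagrangianAlong V t γ s

end LowEnergy

end

open Set Bundle Manifold MeasureTheory
open scoped ContDiff Topology

noncomputable section

namespace LowEnergy

universe u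

section

open Metric unitInterval

/-! ### A smooth inverse function theorem -/

/-! The proof rests on a rescaling. If `(x(s), ξ(s))` is a classical path for `|ξ|²/2 + V` on `[0,
t]`, then `k ↦ (x(tk), t ξ(tk))` solves the Hamilton equations of `|η|²/2 + εV` on `[0, 1]` with `ε
= t²`. Short times and initial momenta below `μ / t` thus become parameters `(ε, η)` near `(0, 0)`,
and the singular limit `t → 0` becomes a regular one.

In a chart around `y` with coordinate `x₀`, consider the endpoint map `(ε, x, η) ↦ (ε, x, x(1))`.
For `ε = 0` the flow is the geodesic flow, which is homogeneous: momentum `lη` at time `1` reaches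
the same position as momentum `η` at time `l`. Hence the derivative of the endpoint in `η` at `(0,
x₀, 0)` is the dual metric, which is invertible, and the inverse function theorem applies
(`exists_hamiltonFlow_endpoint`). Injectivity of the endpoint map gives uniqueness of low-energy
paths (`ChartFlow.exists_eqOn_of_mem_lowClassicalPaths`). Its smooth inverse, which sends `(0, x₀,
x₀)` to zero momentum, gives existence (`ChartFlow.exists_connectingPath_mem_lowClassicalPaths`) and
smoothness. The action is carried along as an extra component of the flow, so it is smooth as well.

Compactness makes the constants uniform. A competing path starts at the same point, hence with the
same potential energy; if it is not the low path, its initial momentum is at least `μ / t`, so its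
energy is larger. Paths built in different charts agree by uniqueness, which also carries smoothness
over to the global family.

Two ingredients are proved along the way: smooth dependence of flows on initial data, from the
inverse function theorem in a space of continuous paths (`exists_contDiffOn_flow_of_contDiff`), and
independence of the Hamilton equations from the chart, because cotangent lifts are symplectic
(`exists_hasFDerivAt_coChart_transition`). -/

theorem exists_openPartialHomeomorph_contDiffOn_symm {X Y : Type*} [NormedAddCommGroup X]
    [NormedSpace ℝ X] [CompleteSpace X] [NormedAddCommGroup Y] [NormedSpace ℝ Y]
    {f : X → Y} {U : Set X} (hU : IsOpen U) (hf : ContDiffOn ℝ ∞ f U) {a : X} (ha : a ∈ U)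
    {f' : X ≃L[ℝ] Y} (hf' : HasFDerivAt f (f' : X →L[ℝ] Y) a) :
    ∃ e : OpenPartialHomeomorph X Y, a ∈ e.source ∧ e.source ⊆ U ∧ (∀ x, e x = f x) ∧
      ContDiffOn ℝ ∞ e.symm e.target := by
  have hfa : ContDiffAt ℝ ∞ f a := hf.contDiffAt (hU.mem_nhds ha)
  have hn : (∞ : WithTop ℕ∞) ≠ 0 := by simp
  let e₀ := hfa.toOpenPartialHomeomorph f hf' hn
  have hcont : ContinuousOn (fderiv ℝ f) U := hf.continuousOn_fderiv_of_isOpen hU (by simp)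
  -- Restricting to the open set where the derivative is invertible makes the inverse smooth at
  -- every point of the target, not only at `f a`.
  have hpre : IsOpen (U ∩ fderiv ℝ f ⁻¹' range ((↑) : (X ≃L[ℝ] Y) → X →L[ℝ] Y)) :=
    hcont.isOpen_inter_preimage hU ContinuousLinearEquiv.isOpen
  refine ⟨e₀.restrOpen _ hpre, ?_, ?_, fun x ↦ rfl, ?_⟩
  · refine ⟨hfa.mem_toOpenPartialHomeomorph_source hf' hn, ha, ?_⟩
    rw [mem_preimage, hf'.fderiv]
    exact mem_range_self f'
  · intro x hx
    exact hx.2.1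
  · intro y hy
    have hx := (e₀.restrOpen _ hpre).map_target hy
    obtain ⟨g, hg⟩ := hx.2.2
    refine ((e₀.restrOpen _ hpre).contDiffAt_symm hy (f₀' := g) ?_ ?_).contDiffWithinAt
    · rw [hg]
      exact ((hf.contDiffAt (hU.mem_nhds hx.2.1)).differentiableAt hn).hasFDerivAt
    · exact hf.contDiffAt (hU.mem_nhds hx.2.1)

/-! ### Superposition operators on spaces of continuous functions -/

section Superposition

variable {K : Type*} [TopologicalSpace K] [CompactSpace K]
  {X Y : Type*} [NormedAddCommGroup X] [NormedSpace ℝ X] [NormedAddCommGroup Y] [NormedSpace ℝ Y]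

/-- Pointwise application of a continuous bilinear map to continuous functions. -/
def pointwiseBilin (K : Type*) [TopologicalSpace K] [CompactSpace K] {X Y Z : Type*}
    [NormedAddCommGroup X] [NormedSpace ℝ X] [NormedAddCommGroup Y] [NormedSpace ℝ Y]
    [NormedAddCommGroup Z] [NormedSpace ℝ Z] (B : Z →L[ℝ] X →L[ℝ] Y) :
    C(K, Z) →L[ℝ] C(K, X) →L[ℝ] C(K, Y) :=
  LinearMap.mkContinuous₂
    (LinearMap.mk₂ ℝ (fun (A : C(K, Z)) (h : C(K, X)) ↦
        (⟨fun k ↦ B (A k) (h k), by fun_prop⟩ : C(K, Y)))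
      (fun _ _ _ ↦ by ext; simp) (fun _ _ _ ↦ by ext; simp) (fun _ _ _ ↦ by ext; simp)
      (fun _ _ _ ↦ by ext; simp)) ‖B‖ (by
    intro A h
    rw [ContinuousMap.norm_le _ (by positivity)]
    intro k
    simp only [LinearMap.mk₂_apply, ContinuousMap.coe_mk]
    refine (B.le_opNorm₂ _ _).trans ?_
    gcongr
    exacts [A.norm_coe_le_norm k, h.norm_coe_le_norm k])

omit [NormedSpace ℝ X] [NormedSpace ℝ Y] in
-- The radius is uniform in `k`: continuity of postcomposition in the sup norm is tested on the
-- perturbation of `u` by the constant `z - u k`.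
theorem exists_pos_forall_ball_dist_le (g : C(X, Y)) (u : C(K, X)) {c : ℝ} (hc : 0 < c) :
    ∃ δ > 0, ∀ k, ∀ z ∈ ball (u k) δ, ‖g z - g (u k)‖ ≤ c := by
  have hcont : ContinuousAt (fun v : C(K, X) ↦ g.comp v) u :=
    (ContinuousMap.continuous_postcomp g).continuousAt
  obtain ⟨δ, hδ, hball⟩ := Metric.continuousAt_iff.1 hcont c hc
  refine ⟨δ, hδ, fun k z hz ↦ ?_⟩
  have hd : dist (u + ContinuousMap.const K (z - u k)) u < δ := by
    rw [dist_eq_norm, add_sub_cancel_left]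
    refine (ContinuousMap.norm_lt_iff _ hδ).2 fun _ ↦ ?_
    simpa [dist_eq_norm] using hz
  have h2 := (ContinuousMap.dist_lt_iff hc).1 (hball hd) k
  simp only [ContinuousMap.comp_apply, ContinuousMap.add_apply, ContinuousMap.const_apply,
    add_sub_cancel, dist_eq_norm] at h2
  exact h2.le

/-- The mean value inequality is applied at each `k` on a ball around `u k` whose radius does not
depend on `k`. -/
theorem hasFDerivAt_superposition {f : X → Y} (hf : ContDiff ℝ 1 f) (u : C(K, X)) :
    HasFDerivAt (fun u : C(K, X) ↦ (⟨f, hf.continuous⟩ : C(X, Y)).comp u)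
      (pointwiseBilin K (.id ℝ (X →L[ℝ] Y))
        ((⟨fderiv ℝ f, hf.continuous_fderiv one_ne_zero⟩ : C(X, X →L[ℝ] Y)).comp u)) u := by
  rw [hasFDerivAt_iff_isLittleO, Asymptotics.isLittleO_iff]
  intro c hc
  obtain ⟨δ, hδ, hbound⟩ := exists_pos_forall_ball_dist_le
    (⟨fderiv ℝ f, hf.continuous_fderiv one_ne_zero⟩ : C(X, X →L[ℝ] Y)) u hc
  filter_upwards [ball_mem_nhds u hδ] with v hv
  rw [ContinuousMap.norm_le _ (by positivity)]
  intro k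
  have hvk : v k ∈ ball (u k) δ := (ContinuousMap.dist_lt_iff hδ).1 hv k
  have hmv := (convex_ball (u k) δ).norm_image_sub_le_of_norm_hasFDerivWithin_le'
    (f := f) (f' := fderiv ℝ f) (φ := fderiv ℝ f (u k))
    (fun z _ ↦ ((hf.differentiable one_ne_zero) z).hasFDerivAt.hasFDerivWithinAt) (hbound k)
    (mem_ball_self hδ) hvk
  refine hmv.trans (mul_le_mul_of_nonneg_left ?_ hc.le)
  exact (v - u).norm_coe_le_norm k

/-- The derivative is again a superposition operator, that of `fderiv ℝ f`, followed by a bounded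
bilinear map. The induction replaces `Y` by `X →L[ℝ] Y`, which is why both spaces lie in one
universe. -/
theorem contDiff_superposition_nat {X : Type u} [NormedAddCommGroup X] [NormedSpace ℝ X] (n : ℕ) :
    ∀ {Y : Type u} [NormedAddCommGroup Y] [NormedSpace ℝ Y] (f : C(X, Y)), ContDiff ℝ n f →
      ContDiff ℝ n (fun u : C(K, X) ↦ f.comp u) := by
  induction n with
  | zero =>
    intro Y _ _ f _
    exact contDiff_zero.2 (ContinuousMap.continuous_postcomp f)
  | succ n ih =>
    intro Y _ _ f hf
    have h1 : ContDiff ℝ 1 f := hf.of_le (by exact_mod_cast Nat.le_add_left 1 n)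
    push_cast
    refine contDiff_succ_iff_hasFDerivAt.2 ⟨fun u ↦ pointwiseBilin K (.id ℝ (X →L[ℝ] Y))
      ((⟨fderiv ℝ f, h1.continuous_fderiv one_ne_zero⟩ : C(X, X →L[ℝ] Y)).comp u), ?_,
      fun u ↦ hasFDerivAt_superposition h1 u⟩
    exact (pointwiseBilin K (.id ℝ (X →L[ℝ] Y))).contDiff.comp
      (ih ⟨fderiv ℝ f, _⟩ (hf.fderiv_right (m := n) (by push_cast; rfl)))

theorem contDiff_superposition {X Y : Type u} [NormedAddCommGroup X] [NormedSpace ℝ X]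
    [NormedAddCommGroup Y] [NormedSpace ℝ Y] (f : C(X, Y)) (hf : ContDiff ℝ ∞ f) :
    ContDiff ℝ ∞ (fun u : C(K, X) ↦ f.comp u) :=
  contDiff_infty.2 fun n ↦ contDiff_superposition_nat n f (hf.of_le (by exact_mod_cast le_top))

end Superposition

/-! ### Uniqueness for autonomous ordinary differential equations -/

/-- Both traces are compact in `O`, and a locally Lipschitz field is Lipschitz on their union;
Grönwall uniqueness then applies. -/
theorem eqOn_of_hasDerivWithinAt {X : Type*} [NormedAddCommGroup X] [NormedSpace ℝ X]
    {f : X → X} {O : Set X} (hO : IsOpen O) (hf : ContDiffOn ℝ 1 f O) {α β : ℝ → X} {T : ℝ}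
    (hα : ∀ s ∈ Icc 0 T, α s ∈ O ∧ HasDerivWithinAt α (f (α s)) (Icc 0 T) s)
    (hβ : ∀ s ∈ Icc 0 T, β s ∈ O ∧ HasDerivWithinAt β (f (β s)) (Icc 0 T) s)
    (h0 : α 0 = β 0) : EqOn α β (Icc 0 T) := by
  have hαc : ContinuousOn α (Icc 0 T) := fun s hs ↦ (hα s hs).2.continuousWithinAt
  have hβc : ContinuousOn β (Icc 0 T) := fun s hs ↦ (hβ s hs).2.continuousWithinAt
  have hcomp : IsCompact (α '' Icc 0 T ∪ β '' Icc 0 T) :=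
    (isCompact_Icc.image_of_continuousOn hαc).union (isCompact_Icc.image_of_continuousOn hβc)
  have hsub : α '' Icc 0 T ∪ β '' Icc 0 T ⊆ O := by
    rintro _ (⟨s, hs, rfl⟩ | ⟨s, hs, rfl⟩)
    exacts [(hα s hs).1, (hβ s hs).1]
  have hloc : LocallyLipschitzOn (α '' Icc 0 T ∪ β '' Icc 0 T) f := by
    intro x hx
    obtain ⟨C, t, ht, hC⟩ :=
      (hf.contDiffAt (hO.mem_nhds (hsub hx))).exists_lipschitzOnWith
    exact ⟨C, t, mem_nhdsWithin_of_mem_nhds ht, hC⟩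
  obtain ⟨C, hC⟩ := hloc.exists_lipschitzOnWith_of_compact hcomp
  have hr : ∀ {γ : ℝ → X}, (∀ s ∈ Icc 0 T, γ s ∈ O ∧ HasDerivWithinAt γ (f (γ s)) (Icc 0 T) s) →
      ∀ s ∈ Ico 0 T, HasDerivWithinAt γ (f (γ s)) (Ici s) s := fun hγ s hs ↦
    (hγ s ⟨hs.1, hs.2.le⟩).2.mono_of_mem_nhdsWithin
      (Filter.mem_of_superset (Icc_mem_nhdsGE hs.2) (Icc_subset_Icc_left hs.1))
  exact ODE_solution_unique_of_mem_Icc_right (v := fun _ ↦ f)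
    (s := fun _ ↦ α '' Icc 0 T ∪ β '' Icc 0 T) (fun _ _ ↦ hC) hαc (hr hα)
    (fun s hs ↦ Or.inl ⟨s, ⟨hs.1, hs.2.le⟩, rfl⟩) hβc (hr hβ)
    (fun s hs ↦ Or.inr ⟨s, ⟨hs.1, hs.2.le⟩, rfl⟩) h0

end

/-! ### Smooth local flows by the inverse function theorem on path space -/

section

open Metric unitInterval

section Flow

variable {W : Type u} [NormedAddCommGroup W] [NormedSpace ℝ W]

omit [NormedSpace ℝ W] in
theorem intervalIntegrable_IccExtend (h : C(I, W)) (a b : ℝ) :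
    IntervalIntegrable (IccExtend zero_le_one h) volume a b :=
  (h.continuous.Icc_extend' (h := zero_le_one)).intervalIntegrable a b

/-- The operator `h ↦ ∫₀^k h` on continuous functions on the unit interval. -/
def primitiveCLM (W : Type*) [NormedAddCommGroup W] [NormedSpace ℝ W] : C(I, W) →L[ℝ] C(I, W) :=
  LinearMap.mkContinuous
    { toFun := fun h ↦ ⟨fun k ↦ ∫ s in (0 : ℝ)..k, IccExtend zero_le_one h s,
        (intervalIntegral.continuous_primitive (intervalIntegrable_IccExtend h) 0).comp
          continuous_subtype_val⟩
      map_add' := fun g h ↦ by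
        ext k
        exact intervalIntegral.integral_add (intervalIntegrable_IccExtend g 0 k)
          (intervalIntegrable_IccExtend h 0 k)
      map_smul' := fun c h ↦ by
        ext k
        exact intervalIntegral.integral_smul c _ } 1 (fun h ↦ by
    rw [ContinuousMap.norm_le _ (by positivity)]
    intro k
    refine (intervalIntegral.norm_integral_le_of_norm_le_const (C := ‖h‖)
      fun s _ ↦ h.norm_coe_le_norm _).trans ?_
    rw [sub_zero, abs_of_nonneg k.2.1, mul_comm]
    exact mul_le_mul_of_nonneg_right k.2.2 (norm_nonneg h))

/-- The defect of `u` as a solution of `u' = τ f(u)`, `u(0) = w`. -/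
def flowDefect (f : C(W, W)) (q : (ℝ × W) × C(I, W)) : (ℝ × W) × C(I, W) :=
  (q.1, q.2 - ContinuousLinearMap.const ℝ I (M := W) q.1.2 - q.1.1 • primitiveCLM W (f.comp q.2))

theorem contDiff_flowDefect (f : C(W, W)) (hf : ContDiff ℝ ∞ f) :
    ContDiff ℝ ∞ (flowDefect f) := by
  refine contDiff_fst.prodMk ((contDiff_snd.sub
    ((ContinuousLinearMap.const ℝ I (M := W)).contDiff.comp
    (contDiff_snd.comp contDiff_fst))).sub ((contDiff_fst.comp contDiff_fst).smul
    ((primitiveCLM W).contDiff.comp ((contDiff_superposition f hf).comp contDiff_snd))))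

/-- At `τ = 0` the integral term carries the factor `τ`, so it contributes nothing to the derivative
in `u`. The differential is triangular with identities on the diagonal. -/
theorem exists_hasFDerivAt_flowDefect (f : C(W, W)) (hf : ContDiff ℝ ∞ f) (w : W) (u : C(I, W)) :
    ∃ f' : ((ℝ × W) × C(I, W)) ≃L[ℝ] ((ℝ × W) × C(I, W)),
      HasFDerivAt (flowDefect f) (f' : ((ℝ × W) × C(I, W)) →L[ℝ] ((ℝ × W) × C(I, W)))
        ((0, w), u) := by
  have hN : HasFDerivAt (fun q : (ℝ × W) × C(I, W) ↦ primitiveCLM W (f.comp q.2)) _ ((0, w), u) :=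
    (((primitiveCLM W).contDiff.comp ((contDiff_superposition f hf).comp
      contDiff_snd)).differentiable (by simp) _).hasFDerivAt
  have hd := (hasFDerivAt_fst (𝕜 := ℝ) (p := (((0, w), u) : (ℝ × W) × C(I, W)))).prodMk
    (((hasFDerivAt_snd (𝕜 := ℝ)).sub
      ((ContinuousLinearMap.const ℝ I (M := W)).hasFDerivAt.comp ((0, w), u)
      (hasFDerivAt_snd.comp ((0, w), u) hasFDerivAt_fst))).sub
      (((hasFDerivAt_fst (𝕜 := ℝ) (E := ℝ) (F := W)).comp ((0, w), u) hasFDerivAt_fst).smul hN))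
  refine ⟨ContinuousLinearEquiv.skewProd (.refl ℝ _) (.refl ℝ _)
    (-(ContinuousLinearMap.const ℝ I (M := W) ∘L .snd ℝ ℝ W) -
      (ContinuousLinearMap.fst ℝ ℝ W).smulRight (primitiveCLM W (f.comp u))), ?_⟩
  convert! hd using 1
  ext q <;> simp [sub_eq_add_neg, add_comm]

/-- Rescaling of the time variable of a path on the unit interval. -/
def timeScale (l : I) (u : C(I, W)) : C(I, W) := u.comp ⟨fun k ↦ l * k, by fun_prop⟩

/-- The substitution `s ↦ l * s` in the integral. It reduces the value at time `l` for speed `τ` to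
the value at time `1` for speed `l * τ`, so evaluation at `1` recovers the whole flow. -/
theorem flowDefect_timeScale (f : C(W, W)) {p : ℝ × W} {u : C(I, W)}
    (hu : flowDefect f (p, u) = (p, 0)) (l : I) :
    flowDefect f ((l * p.1, p.2), timeScale l u) = ((l * p.1, p.2), 0) := by
  have hu2 : ∀ k : I, u k - p.2 - p.1 • ∫ s in (0 : ℝ)..k, IccExtend zero_le_one (f.comp u) s = 0 :=
    fun k ↦ DFunLike.congr_fun (congrArg Prod.snd hu) k
  refine Prod.ext rfl (ContinuousMap.ext fun k ↦ ?_)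
  have h1 := hu2 (l * k)
  have h2 : (l : ℝ) • ∫ s in (0 : ℝ)..k, IccExtend zero_le_one (f.comp (timeScale l u)) s
      = ∫ s in (0 : ℝ)..(l * k : I), IccExtend zero_le_one (f.comp u) s := by
    have h3 := intervalIntegral.smul_integral_comp_mul_left (a := 0) (b := k)
      (IccExtend zero_le_one (f.comp u)) (l : ℝ)
    rw [mul_zero] at h3
    rw [Icc.coe_mul, ← h3]
    congr 1
    refine intervalIntegral.integral_congr fun s hs ↦ ?_
    rw [uIcc_of_le k.2.1] at hs
    have hs1 : s ∈ Icc (0 : ℝ) 1 := ⟨hs.1, hs.2.trans k.2.2⟩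
    have hs2 : l * s ∈ Icc (0 : ℝ) 1 := (l * ⟨s, hs1⟩ : I).2
    simp only [IccExtend_of_mem _ _ hs1, IccExtend_of_mem _ _ hs2]
    rfl
  change u (l * k) - p.2 - (l * p.1) • ∫ s in (0 : ℝ)..k, IccExtend zero_le_one
    (f.comp (timeScale l u)) s = 0
  rw [mul_comm (l : ℝ), mul_smul, h2]
  exact h1

theorem exists_contDiffOn_flow_of_contDiff [CompleteSpace W] {f : W → W} (hf : ContDiff ℝ ∞ f)
    (w₀ : W) {r : ℝ} (hr : 0 < r) :
    ∃ δ > 0, ∃ Φ : ℝ × W → W, ContDiffOn ℝ ∞ Φ (Ioo (-δ) δ ×ˢ ball w₀ δ) ∧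
      ∀ w ∈ ball w₀ δ, Φ (0, w) = w ∧ ∀ τ ∈ Ioo (-δ) δ, Φ (τ, w) ∈ ball w₀ r ∧
        HasDerivAt (fun τ ↦ Φ (τ, w)) (f (Φ (τ, w))) τ := by
  set g : C(W, W) := ⟨f, hf.continuous⟩
  obtain ⟨f', hf'⟩ := exists_hasFDerivAt_flowDefect g hf w₀
    (ContinuousLinearMap.const ℝ I (M := W) w₀)
  obtain ⟨e, hea, -, hef, hes⟩ := exists_openPartialHomeomorph_contDiffOn_symm isOpen_univ
    (contDiff_flowDefect g hf).contDiffOn (mem_univ _) hf'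
  set a : (ℝ × W) × C(I, W) := ((0, w₀), ContinuousLinearMap.const ℝ I (M := W) w₀)
  have hea0 : e a = ((0, w₀), 0) := by
    rw [hef]
    simp [a, flowDefect]
  have hsrc : e.source ∩ ball a r ∈ 𝓝 a :=
    Filter.inter_mem (e.open_source.mem_nhds hea) (ball_mem_nhds a hr)
  obtain ⟨ρ, hρ, hρs⟩ := Metric.mem_nhds_iff.1 hsrc
  have htgt : e.target ∩ e.symm ⁻¹' ball a ρ ∈ 𝓝 (((0, w₀), 0) : (ℝ × W) × C(I, W)) := by
    rw [← hea0]
    refine Filter.inter_mem (e.open_target.mem_nhds (e.map_source hea)) ?_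
    refine (e.continuousAt_symm (e.map_source hea)).preimage_mem_nhds ?_
    rw [e.left_inv hea]
    exact ball_mem_nhds a hρ
  obtain ⟨δ', hδ', hδt'⟩ := Metric.mem_nhds_iff.1 htgt
  -- `δ ≤ δ'` puts the parameters in the target of `e`; `δ ≤ ρ` keeps the rescaled solutions below
  -- in the ball on which `e` is injective.
  obtain ⟨δ, hδ, hδρ, hδδ'⟩ : ∃ δ > 0, δ ≤ ρ ∧ δ ≤ δ' :=
    ⟨min ρ δ', lt_min hρ hδ', min_le_left _ _, min_le_right _ _⟩
  have hP : ∀ p ∈ Ioo (-δ) δ ×ˢ ball w₀ δ,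
      (p, (0 : C(I, W))) ∈ e.target ∧ e.symm (p, 0) ∈ ball a ρ := by
    intro p hp
    refine hδt' ?_
    rw [mem_ball, Prod.dist_eq, Prod.dist_eq, dist_self, Real.dist_eq, sub_zero]
    exact max_lt (max_lt ((abs_lt.2 hp.1).trans_le hδδ') (lt_of_lt_of_le hp.2 hδδ')) hδ'
  set φ : ℝ × W → C(I, W) := fun p ↦ (e.symm (p, 0)).2
  have hsol : ∀ p ∈ Ioo (-δ) δ ×ˢ ball w₀ δ, e.symm (p, 0) = (p, φ p) ∧
      flowDefect g (p, φ p) = (p, 0) := by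
    intro p hp
    have h1 := e.right_inv (hP p hp).1
    have h2 : (e.symm (p, 0)).1 = p := by
      rw [hef] at h1
      exact congrArg Prod.fst h1
    have h3 : e.symm (p, 0) = (p, φ p) := Prod.ext h2 rfl
    refine ⟨h3, ?_⟩
    rw [← hef, ← h3, h1]
  have hball : ∀ p ∈ Ioo (-δ) δ ×ˢ ball w₀ δ, ∀ k, φ p k ∈ ball w₀ ρ := by
    intro p hp k
    have h1 := (hP p hp).2
    rw [(hsol p hp).1, mem_ball, Prod.dist_eq] at h1
    exact (ContinuousMap.dist_lt_iff hρ).1 ((le_max_right _ _).trans_lt h1) k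
  -- The rescaled path has zero defect for the rescaled parameters and lies in the ball inside
  -- `e.source`; injectivity of `e` identifies it with the constructed solution.
  have hscale : ∀ p ∈ Ioo (-δ) δ ×ˢ ball w₀ δ, ∀ l : I,
      (l * p.1, p.2) ∈ Ioo (-δ) δ ×ˢ ball w₀ δ ∧ φ (l * p.1, p.2) = timeScale l (φ p) := by
    intro p hp l
    have hl : (l * p.1, p.2) ∈ Ioo (-δ) δ ×ˢ ball w₀ δ := by
      refine ⟨abs_lt.1 ?_, hp.2⟩
      rw [abs_mul, abs_of_nonneg l.2.1]
      exact (mul_le_of_le_one_left (abs_nonneg _) l.2.2).trans_lt (abs_lt.2 hp.1)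
    refine ⟨hl, ?_⟩
    have hmem : ((l * p.1, p.2), timeScale l (φ p)) ∈ ball a ρ := by
      rw [mem_ball, Prod.dist_eq, Prod.dist_eq, Real.dist_eq, sub_zero]
      refine max_lt (max_lt ((abs_lt.2 hl.1).trans_le hδρ) (lt_of_lt_of_le hl.2 hδρ)) ?_
      exact (ContinuousMap.dist_lt_iff hρ).2 fun k ↦ hball p hp _
    have h1 := e.left_inv (hρs hmem).1
    rw [hef, flowDefect_timeScale g (hsol p hp).2 l] at h1
    exact congrArg Prod.snd h1
  set Φ : ℝ × W → W := fun p ↦ φ p 1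
  have hΦ : ∀ p ∈ Ioo (-δ) δ ×ˢ ball w₀ δ, ∀ l : I, φ p l = Φ (l * p.1, p.2) := by
    intro p hp l
    simp only [Φ, (hscale p hp l).2, timeScale, ContinuousMap.comp_apply, ContinuousMap.coe_mk,
      mul_one]
  have hΦs : ContDiffOn ℝ ∞ Φ (Ioo (-δ) δ ×ˢ ball w₀ δ) := by
    refine (ContinuousMap.evalCLM ℝ (1 : I) (M := W)).contDiff.comp_contDiffOn
      (contDiff_snd.comp_contDiffOn (hes.comp ?_ fun p hp ↦ (hP p hp).1))
    exact (contDiff_id.prodMk contDiff_const).contDiffOn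
  have hint : ∀ w ∈ ball w₀ δ, ∀ τ ∈ Ioo (-δ) δ,
      Φ (τ, w) = w + ∫ s in (0 : ℝ)..τ, f (Φ (s, w)) := by
    intro w hw τ hτ
    have hp : ((τ, w) : ℝ × W) ∈ Ioo (-δ) δ ×ˢ ball w₀ δ := ⟨hτ, hw⟩
    have h1 : φ (τ, w) 1 - w - τ • ∫ s in (0 : ℝ)..(1 : I),
        IccExtend zero_le_one (g.comp (φ (τ, w))) s = 0 :=
      DFunLike.congr_fun (congrArg Prod.snd (hsol _ hp).2) 1
    have h2 : (∫ s in (0 : ℝ)..(1 : I), IccExtend zero_le_one (g.comp (φ (τ, w))) s)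
        = ∫ s in (0 : ℝ)..1, f (Φ (s * τ, w)) := by
      refine intervalIntegral.integral_congr fun s hs ↦ ?_
      rw [Icc.coe_one, uIcc_of_le zero_le_one] at hs
      simp only [IccExtend_of_mem _ _ hs]
      exact congrArg f (hΦ _ hp ⟨s, hs⟩)
    rw [h2, intervalIntegral.smul_integral_comp_mul_right (fun s ↦ f (Φ (s, w))), zero_mul,
      one_mul, sub_sub, sub_eq_zero] at h1
    exact h1
  have h0 : (0 : ℝ) ∈ Ioo (-δ) δ := ⟨neg_lt_zero.2 hδ, hδ⟩
  refine ⟨δ, hδ, Φ, hΦs, fun w hw ↦ ⟨by simp [hint w hw 0 h0], fun τ hτ ↦ ⟨?_, ?_⟩⟩⟩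
  · have h1 := (hP (τ, w) ⟨hτ, hw⟩).2
    have h2 := (hρs h1).2
    rw [(hsol (τ, w) ⟨hτ, hw⟩).1, mem_ball, Prod.dist_eq] at h2
    exact (ContinuousMap.dist_lt_iff hr).1 ((le_max_right _ _).trans_lt h2) 1
  · have hc : ContinuousOn (fun s ↦ f (Φ (s, w))) (Ioo (-δ) δ) :=
      hf.continuous.comp_continuousOn (hΦs.continuousOn.comp (by fun_prop) fun s hs ↦ ⟨hs, hw⟩)
    have hsub : uIcc 0 τ ⊆ Ioo (-δ) δ := ordConnected_Ioo.uIcc_subset h0 hτ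
    have hd := (intervalIntegral.integral_hasDerivAt_right
      (hc.mono hsub).intervalIntegrable
      (hc.stronglyMeasurableAtFilter isOpen_Ioo τ hτ)
      (hc.continuousAt (isOpen_Ioo.mem_nhds hτ))).const_add w
    refine hd.congr_of_eventuallyEq ?_
    filter_upwards [isOpen_Ioo.mem_nhds hτ] with s hs using hint w hw s hs

/-- A smooth vector field on an open subset of a finite-dimensional space has a smooth local flow
near each point. -/
theorem exists_contDiffOn_flow [FiniteDimensional ℝ W] {f : W → W} {O : Set W} (hO : IsOpen O)
    (hf : ContDiffOn ℝ ∞ f O) {w₀ : W} (hw₀ : w₀ ∈ O) :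
    ∃ δ > 0, ∃ Φ : ℝ × W → W, ContDiffOn ℝ ∞ Φ (Ioo (-δ) δ ×ˢ ball w₀ δ) ∧
      ∀ w ∈ ball w₀ δ, Φ (0, w) = w ∧ ∀ τ ∈ Ioo (-δ) δ, Φ (τ, w) ∈ O ∧
        HasDerivAt (fun τ ↦ Φ (τ, w)) (f (Φ (τ, w))) τ := by
  have : CompleteSpace W := FiniteDimensional.complete ℝ W
  obtain ⟨r, hr, hrO⟩ := Metric.isOpen_iff.1 hO w₀ hw₀
  -- The cut-off field is globally smooth and equals `f` on the ball of radius `r / 3`, to which its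
  -- flow is confined.
  let χ : ContDiffBump w₀ := ⟨r / 3, r / 2, by positivity, by linarith⟩
  have hsm : ContDiff ℝ ∞ (fun w ↦ χ w • f w) := by
    refine contDiff_iff_contDiffAt.2 fun w ↦ ?_
    by_cases hw : w ∈ ball w₀ r
    · exact χ.contDiff.contDiffAt.smul (hf.contDiffAt (hO.mem_nhds (hrO hw)))
    · have hw2 : w ∈ (closedBall w₀ (r / 2))ᶜ := fun h ↦
        hw (closedBall_subset_ball (by linarith) h)
      refine (contDiffAt_const (c := (0 : W))).congr_of_eventuallyEq ?_
      filter_upwards [isClosed_closedBall.isOpen_compl.mem_nhds hw2] with z hz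
      rw [χ.zero_of_le_dist, zero_smul]
      exact (not_le.1 (fun h ↦ hz (mem_closedBall.2 h))).le
  obtain ⟨δ, hδ, Φ, hΦ, h⟩ := exists_contDiffOn_flow_of_contDiff hsm w₀ (r := r / 3) (by positivity)
  refine ⟨δ, hδ, Φ, hΦ, fun w hw ↦ ⟨(h w hw).1, fun τ hτ ↦ ?_⟩⟩
  obtain ⟨h1, h2⟩ := (h w hw).2 τ hτ
  refine ⟨hrO (ball_subset_ball (by linarith) h1), ?_⟩
  rwa [χ.one_of_mem_closedBall (ball_subset_closedBall h1), one_smul] at h2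

end Flow

end

/-! ### The rescaled Hamilton flow in a chart and its endpoint map -/

section

open Metric

theorem _root_.HasDerivAt.fst_comp {X Y : Type*} [NormedAddCommGroup X] [NormedSpace ℝ X]
    [NormedAddCommGroup Y] [NormedSpace ℝ Y] {g : ℝ → X × Y} {g' : X × Y} {k : ℝ}
    (h : HasDerivAt g g' k) : HasDerivAt (fun k ↦ (g k).1) g'.1 k :=
  (ContinuousLinearMap.fst ℝ X Y).hasFDerivAt.comp_hasDerivAt k h

theorem _root_.HasDerivAt.snd_comp {X Y : Type*} [NormedAddCommGroup X] [NormedSpace ℝ X]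
    [NormedAddCommGroup Y] [NormedSpace ℝ Y] {g : ℝ → X × Y} {g' : X × Y} {k : ℝ}
    (h : HasDerivAt g g' k) : HasDerivAt (fun k ↦ (g k).2) g'.2 k :=
  (ContinuousLinearMap.snd ℝ X Y).hasFDerivAt.comp_hasDerivAt k h

theorem _root_.HasDerivAt.comp_const_mul' {X : Type*} [NormedAddCommGroup X] [NormedSpace ℝ X]
    {g : ℝ → X} {g' : X} {c s : ℝ} (h : HasDerivAt g g' (c * s)) :
    HasDerivAt (fun s ↦ g (c * s)) (c • g') s := by
  have := HasDerivAt.scomp (g₁ := g) (h := fun s ↦ c * s) s h ((hasDerivAt_id s).const_mul c)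
  rwa [mul_one] at this

section ChartFlow

set_option synthInstance.maxHeartbeats 200000

variable {E : Type u} [NormedAddCommGroup E] [NormedSpace ℝ E]

/-- The Hamilton vector field of `(x, ξ) ↦ ξ(A(x) ξ) / 2 + ε v(x)` in canonical coordinates, for
symmetric `A`. -/
def hamiltonField (A : E → (E →L[ℝ] ℝ) →L[ℝ] E) (v : E → ℝ) (ε : ℝ) (z : E × (E →L[ℝ] ℝ)) :
    E × (E →L[ℝ] ℝ) :=
  (A z.1 z.2, -((1 / 2 : ℝ) • (z.2 ∘L (fderiv ℝ A z.1).flip z.2)) - ε • fderiv ℝ v z.1)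

/-- The Lagrangian `ξ(A(x) ξ) / 2 - ε v(x)` as a function on phase space. -/
def phaseLagrangian (A : E → (E →L[ℝ] ℝ) →L[ℝ] E) (v : E → ℝ) (ε : ℝ) (z : E × (E →L[ℝ] ℝ)) :
    ℝ :=
  (1 / 2) * z.2 (A z.1 z.2) - ε * v z.1

/-- Multiplication of the momentum by `c`. -/
def scaleMomentum (c : ℝ) (z : E × (E →L[ℝ] ℝ)) : E × (E →L[ℝ] ℝ) := (z.1, c • z.2)

variable {A : E → (E →L[ℝ] ℝ) →L[ℝ] E} {v : E → ℝ} {O : Set E}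

theorem contDiffOn_flip_fderiv_apply {X F Y : Type*} [NormedAddCommGroup X] [NormedSpace ℝ X]
    [NormedAddCommGroup F] [NormedSpace ℝ F] [NormedAddCommGroup Y] [NormedSpace ℝ Y]
    {B : X → F →L[ℝ] Y} {U : Set X} (hU : IsOpen U) (hB : ContDiffOn ℝ ∞ B U) :
    ContDiffOn ℝ ∞ (fun w : ℝ × X × F ↦ (fderiv ℝ B w.2.1).flip w.2.2) {w | w.2.1 ∈ U} := by
  have hB' : ContDiffOn ℝ ∞ (fderiv ℝ B) U := hB.fderiv_of_isOpen hU (by simp)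
  have hB2 : ContDiffOn ℝ ∞ (fun w : ℝ × X × F ↦ fderiv ℝ B w.2.1) {w | w.2.1 ∈ U} :=
    hB'.comp (contDiff_fst.comp contDiff_snd).contDiffOn fun _ h ↦ h
  have hbd : IsBoundedLinearMap ℝ (fun b : X →L[ℝ] F →L[ℝ] Y ↦ b.flip) :=
    ⟨⟨fun _ _ ↦ rfl, fun _ _ ↦ rfl⟩, 1, one_pos, fun x ↦ by simp⟩
  have hfl : ContDiff ℝ ∞ (fun b : X →L[ℝ] F →L[ℝ] Y ↦ b.flip) := hbd.contDiff
  have hflip : ContDiffOn ℝ ∞ (fun w : ℝ × X × F ↦ (fderiv ℝ B w.2.1).flip) {w | w.2.1 ∈ U} :=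
    hfl.comp_contDiffOn hB2
  exact hflip.clm_apply (contDiff_snd.comp contDiff_snd).contDiffOn

theorem contDiffOn_hamiltonField (hO : IsOpen O) (hA : ContDiffOn ℝ ∞ A O)
    (hv : ContDiffOn ℝ ∞ v O) :
    ContDiffOn ℝ ∞ (fun w : ℝ × E × (E →L[ℝ] ℝ) ↦ hamiltonField A v w.1 w.2)
      {w | w.2.1 ∈ O} := by
  have hfst : ContDiffOn ℝ ∞ (fun w : ℝ × E × (E →L[ℝ] ℝ) ↦ w.2.1) {w | w.2.1 ∈ O} := by fun_prop
  have hmom : ContDiffOn ℝ ∞ (fun w : ℝ × E × (E →L[ℝ] ℝ) ↦ w.2.2) {w | w.2.1 ∈ O} := by fun_prop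
  have hA' := contDiffOn_flip_fderiv_apply hO hA
  have hv' : ContDiffOn ℝ ∞ (fderiv ℝ v) O := hv.fderiv_of_isOpen hO (by simp)
  have h1 : ContDiffOn ℝ ∞ (fun w : ℝ × E × (E →L[ℝ] ℝ) ↦ A w.2.1 w.2.2) {w | w.2.1 ∈ O} :=
    (hA.comp hfst fun _ h ↦ h).clm_apply hmom
  have h2 := ((hmom.clm_comp hA').const_smul (1 / 2 : ℝ)).neg
  have h3 : ContDiffOn ℝ ∞ (fun w : ℝ × E × (E →L[ℝ] ℝ) ↦ w.1 • fderiv ℝ v w.2.1)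
    {w | w.2.1 ∈ O} := contDiffOn_fst.smul (hv'.comp hfst fun _ h ↦ h)
  exact h1.prodMk (h2.sub h3)

theorem contDiffOn_phaseLagrangian (hA : ContDiffOn ℝ ∞ A O) (hv : ContDiffOn ℝ ∞ v O) :
    ContDiffOn ℝ ∞ (fun w : ℝ × E × (E →L[ℝ] ℝ) ↦ phaseLagrangian A v w.1 w.2)
      {w | w.2.1 ∈ O} := by
  have hfst : ContDiffOn ℝ ∞ (fun w : ℝ × E × (E →L[ℝ] ℝ) ↦ w.2.1) {w | w.2.1 ∈ O} := by fun_prop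
  have hmom : ContDiffOn ℝ ∞ (fun w : ℝ × E × (E →L[ℝ] ℝ) ↦ w.2.2) {w | w.2.1 ∈ O} := by fun_prop
  exact (contDiffOn_const.mul (hmom.clm_apply ((hA.comp hfst fun _ h ↦ h).clm_apply hmom))).sub
    (contDiffOn_fst.mul (hv.comp hfst fun _ h ↦ h))

/-- The velocity is linear and the metric force quadratic in the momentum, so both are compatible
with the scaling. The potential force gains one factor `c` from time and one from momentum, hence `c
^ 2 * ε`. -/
theorem hasDerivAt_scaleMomentum {z : ℝ → E × (E →L[ℝ] ℝ)} {c ε s : ℝ}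
    (hz : HasDerivAt z (hamiltonField A v ε (z (c * s))) (c * s)) :
    HasDerivAt (fun s ↦ scaleMomentum c (z (c * s)))
      (hamiltonField A v (c ^ 2 * ε) (scaleMomentum c (z (c * s)))) s := by
  have hc := hz.comp_const_mul'
  have h1 := hc.fst_comp.prodMk (hc.snd_comp.const_smul c)
  have h2 : (fun s ↦ scaleMomentum c (z (c * s))) =
    fun s ↦ ((z (c * s)).1, c • (z (c * s)).2) := rfl
  rw [h2]
  convert! h1 using 1
  refine Prod.ext ?_ ?_
  · simp [hamiltonField, scaleMomentum]
  · ext w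
    simp [hamiltonField, scaleMomentum]
    ring

theorem hasDerivAt_scaleMomentum_action {z : ℝ → E × (E →L[ℝ] ℝ)} {a : ℝ → ℝ} {c ε s : ℝ}
    (ha : HasDerivAt a (phaseLagrangian A v ε (z (c * s))) (c * s)) :
    HasDerivAt (fun s ↦ c * a (c * s))
      (phaseLagrangian A v (c ^ 2 * ε) (scaleMomentum c (z (c * s)))) s := by
  convert! ha.comp_const_mul'.const_mul c using 1
  simp [phaseLagrangian, scaleMomentum]
  ring

/-- Near the zero section and `ε = 0`, the Hamilton flow of `ξ(A(x) ξ) / 2 + ε v(x)` and its action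
exist up to time `1` and are smooth. -/
theorem exists_contDiffOn_hamiltonFlow [FiniteDimensional ℝ E] (hO : IsOpen O)
    (hA : ContDiffOn ℝ ∞ A O) (hv : ContDiffOn ℝ ∞ v O) {x₀ : E} (hx₀ : x₀ ∈ O) :
    ∃ (U : Set (ℝ × E × (E →L[ℝ] ℝ))) (Z : ℝ × ℝ × E × (E →L[ℝ] ℝ) → (E × (E →L[ℝ] ℝ)) × ℝ),
      IsOpen U ∧ Convex ℝ U ∧ (0, x₀, 0) ∈ U ∧ ContDiffOn ℝ ∞ Z (Ioo (-1) 2 ×ˢ U) ∧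
      ∀ p ∈ U, Z (0, p) = (p.2, 0) ∧ ∀ k ∈ Ioo (-1 : ℝ) 2, (Z (k, p)).1.1 ∈ O ∧
        HasDerivAt (fun k ↦ (Z (k, p)).1) (hamiltonField A v p.1 (Z (k, p)).1) k ∧
        HasDerivAt (fun k ↦ (Z (k, p)).2) (phaseLagrangian A v p.1 (Z (k, p)).1) k := by
  -- The parameter `ε` joins the state as a constant component and the action as a driven one, so a
  -- single autonomous flow theorem gives joint smoothness.
  let f : (ℝ × E × (E →L[ℝ] ℝ)) × ℝ → (ℝ × E × (E →L[ℝ] ℝ)) × ℝ := fun w ↦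
    ((0, hamiltonField A v w.1.1 w.1.2), phaseLagrangian A v w.1.1 w.1.2)
  have hf : ContDiffOn ℝ ∞ f {w | w.1.2.1 ∈ O} := by
    refine (contDiffOn_const.prodMk ?_).prodMk ?_
    · exact (contDiffOn_hamiltonField hO hA hv).comp contDiffOn_fst fun _ h ↦ h
    · exact (contDiffOn_phaseLagrangian hA hv).comp contDiffOn_fst fun _ h ↦ h
  have hO' : IsOpen {w : (ℝ × E × (E →L[ℝ] ℝ)) × ℝ | w.1.2.1 ∈ O} :=
    hO.preimage (by fun_prop)
  obtain ⟨δ, hδ, Φ, hΦ, h⟩ := exists_contDiffOn_flow hO' hf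
    (w₀ := ((0, x₀, 0), 0)) hx₀
  -- The flow exists only for times below `δ`. Rescaling time by `T = δ / 2` makes the range `(-1,
  -- 2)` fit.
  obtain ⟨T, hT, rfl⟩ : ∃ T > 0, δ = 2 * T := ⟨δ / 2, by positivity, by ring⟩
  have hT2 : ∀ k ∈ Ioo (-1 : ℝ) 2, T * k ∈ Ioo (-(2 * T)) (2 * T) := fun k hk ↦
    ⟨by nlinarith [hk.1, hk.2], by nlinarith [hk.1, hk.2]⟩
  -- The initial data are divided by the factors `T ^ 2` and `T` that the scaling by `T` will
  -- restore.
  let ι : ℝ × E × (E →L[ℝ] ℝ) →L[ℝ] (ℝ × E × (E →L[ℝ] ℝ)) × ℝ :=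
    ((((T ^ 2)⁻¹ • ContinuousLinearMap.fst ℝ ℝ (E × (E →L[ℝ] ℝ))).prod
      ((ContinuousLinearMap.fst ℝ E (E →L[ℝ] ℝ) ∘L
        ContinuousLinearMap.snd ℝ ℝ (E × (E →L[ℝ] ℝ))).prod
        (T⁻¹ • (ContinuousLinearMap.snd ℝ E (E →L[ℝ] ℝ) ∘L
          ContinuousLinearMap.snd ℝ ℝ (E × (E →L[ℝ] ℝ)))))).prod 0)
  have hι : ∀ p, ι p = (((T ^ 2)⁻¹ * p.1, p.2.1, T⁻¹ • p.2.2), 0) := fun p ↦ rfl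
  let U := ι ⁻¹' ball ((0, x₀, 0), 0) (2 * T)
  have hconst : ∀ p ∈ U, ∀ k ∈ Ioo (-(2 * T)) (2 * T), (Φ (k, ι p)).1.1 = (T ^ 2)⁻¹ * p.1 := by
    intro p hp k hk
    have h0 : (0 : ℝ) ∈ Ioo (-(2 * T)) (2 * T) := ⟨by linarith, by linarith⟩
    have hd : ∀ k ∈ Ioo (-(2 * T)) (2 * T), HasDerivAt (fun k ↦ (Φ (k, ι p)).1.1) 0 k :=
      fun k hk ↦ ((h _ hp).2 k hk).2.fst_comp.fst_comp
    have := (isOpen_Ioo (a := -(2 * T)) (b := 2 * T)).is_const_of_deriv_eq_zero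
      isPreconnected_Ioo (fun k hk ↦ (hd k hk).differentiableAt.differentiableWithinAt)
      (fun k hk ↦ (hd k hk).deriv) hk h0
    rw [this, (h _ hp).1, hι]
  refine ⟨U, fun q ↦ (scaleMomentum T (Φ (T * q.1, ι q.2)).1.2, T * (Φ (T * q.1, ι q.2)).2),
    isOpen_ball.preimage ι.continuous, (convex_ball _ _).linear_preimage ι.toLinearMap, ?_, ?_, ?_⟩
  · simp [U, hι, hT]
  · have h1 : ContDiffOn ℝ ∞ (fun q : ℝ × ℝ × E × (E →L[ℝ] ℝ) ↦ Φ (T * q.1, ι q.2))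
        (Ioo (-1) 2 ×ˢ U) :=
      hΦ.comp ((contDiff_const.mul contDiff_fst).prodMk
        (ι.contDiff.comp contDiff_snd)).contDiffOn fun q hq ↦ ⟨hT2 _ hq.1, hq.2⟩
    have h2 := h1.fst.snd
    exact (h2.fst.prodMk (h2.snd.const_smul T)).prodMk (contDiffOn_const.mul h1.snd)
  · intro p hp
    have hTne : T ≠ 0 := hT.ne'
    have hε : T ^ 2 * ((T ^ 2)⁻¹ * p.1) = p.1 := by field_simp
    refine ⟨?_, fun k hk ↦ ?_⟩
    · simp only [mul_zero]
      rw [(h _ hp).1, hι]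
      simp [scaleMomentum, hTne]
    · obtain ⟨h1, h2⟩ := (h _ hp).2 (T * k) (hT2 k hk)
      refine ⟨h1, ?_, ?_⟩
      · have h3 := h2.fst_comp.snd_comp
        simp only [f] at h3
        rw [hconst p hp _ (hT2 k hk)] at h3
        have h4 := hasDerivAt_scaleMomentum h3
        rwa [hε] at h4
      · have h3 := h2.snd_comp
        simp only [f] at h3
        rw [hconst p hp _ (hT2 k hk)] at h3
        have h4 := hasDerivAt_scaleMomentum_action (z := fun k ↦ (Φ (k, ι p)).1.2) h3
        rwa [hε] at h4

/-- Near the zero section and `ε = 0`, the endpoint map of the Hamilton flow in time `1` is a local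
diffeomorphism. -/
theorem exists_hamiltonFlow_endpoint [FiniteDimensional ℝ E] (hO : IsOpen O)
    (hA : ContDiffOn ℝ ∞ A O) (hv : ContDiffOn ℝ ∞ v O) {x₀ : E} (hx₀ : x₀ ∈ O)
    (hinj : Function.Injective (A x₀)) :
    ∃ (e : OpenPartialHomeomorph (ℝ × E × (E →L[ℝ] ℝ)) (ℝ × E × E))
      (Z : ℝ × ℝ × E × (E →L[ℝ] ℝ) → (E × (E →L[ℝ] ℝ)) × ℝ),
      (0, x₀, 0) ∈ e.source ∧ e (0, x₀, 0) = (0, x₀, x₀) ∧ ContDiffOn ℝ ∞ e.symm e.target ∧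
      ContDiffOn ℝ ∞ Z (Ioo (-1) 2 ×ˢ e.source) ∧
      ∀ p ∈ e.source, e p = (p.1, p.2.1, (Z (1, p)).1.1) ∧ Z (0, p) = (p.2, 0) ∧
        ∀ k ∈ Ioo (-1 : ℝ) 2, (Z (k, p)).1.1 ∈ O ∧
        HasDerivAt (fun k ↦ (Z (k, p)).1) (hamiltonField A v p.1 (Z (k, p)).1) k ∧
        HasDerivAt (fun k ↦ (Z (k, p)).2) (phaseLagrangian A v p.1 (Z (k, p)).1) k := by
  obtain ⟨U, Z, hU, hUc, hp₀, hZ, h⟩ := exists_contDiffOn_hamiltonFlow hO hA hv hx₀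
  have hfield : ContDiffOn ℝ 1 (hamiltonField A v 0) {z | z.1 ∈ O} :=
    ((contDiffOn_hamiltonField hO hA hv).comp (contDiff_const.prodMk contDiff_id).contDiffOn
      fun _ h ↦ h).of_le (by simp)
  have hmem : ∀ {k}, k ∈ Icc (0 : ℝ) 1 → k ∈ Ioo (-1 : ℝ) 2 := fun hk ↦
    ⟨by linarith [hk.1], by linarith [hk.2]⟩
  have hseg : ∀ {η : E →L[ℝ] ℝ}, (0, x₀, η) ∈ U → ∀ l ∈ Icc (0 : ℝ) 1, (0, x₀, l • η) ∈ U := by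
    intro η hη l hl
    have := hUc hp₀ hη (sub_nonneg.2 hl.2) hl.1 (by ring)
    simpa [← add_smul] using this
  -- Homogeneity of the geodesic flow: at `ε = 0` the scaling keeps the equation, and both curves
  -- start at `(x₀, l • η)`.
  have hhom : ∀ η : E →L[ℝ] ℝ, (0, x₀, η) ∈ U → ∀ l ∈ Icc (0 : ℝ) 1,
      (Z (1, 0, x₀, l • η)).1.1 = (Z (l, 0, x₀, η)).1.1 := by
    intro η hη l hl
    have hls : ∀ s ∈ Icc (0 : ℝ) 1, l * s ∈ Icc (0 : ℝ) 1 := fun s hs ↦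
      ⟨mul_nonneg hl.1 hs.1, mul_le_one₀ hl.2 hs.1 hs.2⟩
    have heq := eqOn_of_hasDerivWithinAt (hO.preimage continuous_fst) hfield (T := 1)
      (α := fun s ↦ (Z (s, 0, x₀, l • η)).1)
      (β := fun s ↦ scaleMomentum l (Z (l * s, 0, x₀, η)).1)
      (fun s hs ↦ ⟨((h _ (hseg hη l hl)).2 s (hmem hs)).1,
        ((h _ (hseg hη l hl)).2 s (hmem hs)).2.1.hasDerivWithinAt⟩)
      (fun s hs ↦ ⟨((h _ hη).2 _ (hmem (hls s hs))).1, by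
        have := hasDerivAt_scaleMomentum ((h _ hη).2 _ (hmem (hls s hs))).2.1
        rw [mul_zero] at this
        exact this.hasDerivWithinAt⟩)
      (by simp [(h _ hη).1, (h _ (hseg hη l hl)).1, scaleMomentum]) (right_mem_Icc.2 zero_le_one)
    simpa [scaleMomentum] using congrArg Prod.fst heq
  let X : ℝ × E × (E →L[ℝ] ℝ) → E := fun p ↦ (Z (1, p)).1.1
  have hX : ContDiffOn ℝ ∞ X U :=
    (hZ.comp (contDiff_const.prodMk contDiff_id).contDiffOn
      fun p hp ↦ ⟨hmem (right_mem_Icc.2 zero_le_one), hp⟩).fst.fst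
  have hG : ContDiffOn ℝ ∞ (fun p ↦ (p.1, p.2.1, X p)) U :=
    contDiffOn_fst.prodMk (contDiffOn_snd.fst.prodMk hX)
  have hXd : HasFDerivAt X (fderiv ℝ X (0, x₀, 0)) (0, x₀, 0) :=
    ((hX.contDiffAt (hU.mem_nhds hp₀)).differentiableAt (by simp)).hasFDerivAt
  -- The curve `l ↦ X (0, x₀, l • η)` is the position along the geodesic, so its derivative at `l =
  -- 0` is the initial velocity. The flow identity is known only for `l ∈ [0, 1]`, hence the
  -- one-sided derivatives.
  have hL : ∀ η : E →L[ℝ] ℝ, (0, x₀, η) ∈ U → fderiv ℝ X (0, x₀, 0) (0, 0, η) = A x₀ η := by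
    intro η hη
    have h1 : HasDerivWithinAt (fun l : ℝ ↦ X (0, x₀, l • η)) (fderiv ℝ X (0, x₀, 0) (0, 0, η))
        (Icc 0 1) 0 := by
      have hline : HasDerivAt (fun l : ℝ ↦ ((0, x₀, l • η) : ℝ × E × (E →L[ℝ] ℝ))) (0, 0, η) 0 :=
        (hasDerivAt_const _ _).prodMk ((hasDerivAt_const _ _).prodMk
          (by simpa using (hasDerivAt_id (0 : ℝ)).smul_const η))
      have h2 : HasFDerivAt X (fderiv ℝ X (0, x₀, 0)) (0, x₀, (0 : ℝ) • η) := by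
        rwa [zero_smul]
      exact (h2.comp_hasDerivAt (0 : ℝ) hline).hasDerivWithinAt
    have h2 : HasDerivWithinAt (fun l : ℝ ↦ X (0, x₀, l • η)) (A x₀ η) (Icc 0 1) 0 := by
      have h3 := ((h _ hη).2 0 (hmem (left_mem_Icc.2 zero_le_one))).2.1.fst_comp
      rw [(h _ hη).1] at h3
      exact h3.hasDerivWithinAt.congr (fun l hl ↦ hhom η hη l hl)
        (hhom η hη 0 (left_mem_Icc.2 zero_le_one))
    exact (uniqueDiffOn_Icc zero_lt_one 0 (left_mem_Icc.2 zero_le_one)).eq_deriv _ h1 h2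
  have hLinj : ∀ η : E →L[ℝ] ℝ, fderiv ℝ X (0, x₀, 0) (0, 0, η) = 0 → η = 0 := by
    intro η hη
    have hcont : ContinuousAt (fun l : ℝ ↦ ((0, x₀, l • η) : ℝ × E × (E →L[ℝ] ℝ))) 0 := by fun_prop
    -- `hL` is available only for momenta in `U`, so `η` is replaced by a small nonzero multiple.
    have hev : ∀ᶠ l : ℝ in 𝓝 0, ((0, x₀, l • η) : ℝ × E × (E →L[ℝ] ℝ)) ∈ U :=
      hcont.preimage_mem_nhds (hU.mem_nhds (by simpa using hp₀))
    obtain ⟨l, hl, hl0⟩ := ((hev.filter_mono nhdsWithin_le_nhds).and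
      (self_mem_nhdsWithin (a := (0 : ℝ)) (s := {0}ᶜ))).exists
    have h1 := hL _ hl
    have h2 : ((0, 0, l • η) : ℝ × E × (E →L[ℝ] ℝ)) = l • (0, 0, η) := by simp
    rw [h2, map_smul, hη, smul_zero, eq_comm, ← map_zero (A x₀)] at h1
    exact (smul_eq_zero.1 (hinj h1)).resolve_left hl0
  let D : ℝ × E × (E →L[ℝ] ℝ) →L[ℝ] ℝ × E × E :=
    (ContinuousLinearMap.fst ℝ ℝ (E × (E →L[ℝ] ℝ))).prod
      ((ContinuousLinearMap.fst ℝ E (E →L[ℝ] ℝ) ∘L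
        ContinuousLinearMap.snd ℝ ℝ (E × (E →L[ℝ] ℝ))).prod (fderiv ℝ X (0, x₀, 0)))
  have hD : HasFDerivAt (fun p ↦ (p.1, p.2.1, X p)) D (0, x₀, 0) :=
    hasFDerivAt_fst.prodMk ((hasFDerivAt_fst.comp _ hasFDerivAt_snd).prodMk hXd)
  have hDinj : Function.Injective D.toLinearMap := by
    rw [← LinearMap.ker_eq_bot, LinearMap.ker_eq_bot']
    rintro ⟨a, b, η⟩ hab
    have h1 : a = 0 := congrArg Prod.fst hab
    have h2 : b = 0 := congrArg (fun q ↦ q.2.1) hab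
    have h3 : fderiv ℝ X (0, x₀, 0) (a, b, η) = 0 := congrArg (fun q ↦ q.2.2) hab
    subst h1 h2
    rw [hLinj η h3]
    rfl
  have hrank : Module.finrank ℝ (ℝ × E × (E →L[ℝ] ℝ)) = Module.finrank ℝ (ℝ × E × E) := by
    have : Module.finrank ℝ (E →L[ℝ] ℝ) = Module.finrank ℝ E := by
      rw [← (LinearMap.toContinuousLinearMap (𝕜 := ℝ) (E := E) (F' := ℝ)).finrank_eq]
      exact Subspace.dual_finrank_eq
    simp [this]
  let D' := (LinearMap.linearEquivOfInjective D.toLinearMap hDinj hrank).toContinuousLinearEquiv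
  have hD' : HasFDerivAt (fun p ↦ (p.1, p.2.1, X p))
      (D' : ℝ × E × (E →L[ℝ] ℝ) →L[ℝ] ℝ × E × E) (0, x₀, 0) := by
    convert! hD using 1
  have : CompleteSpace E := FiniteDimensional.complete ℝ E
  obtain ⟨e, hes, heU, hef, hsymm⟩ :=
    exists_openPartialHomeomorph_contDiffOn_symm hU hG hp₀ hD'
  refine ⟨e, Z, hes, ?_, hsymm, hZ.mono (prod_mono_right heU),
    fun p hp ↦ ⟨hef p, h p (heU hp)⟩⟩
  have := hhom 0 hp₀ 0 (left_mem_Icc.2 zero_le_one)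
  rw [smul_zero, (h _ hp₀).1] at this
  rw [hef]
  simp [X, this]

end ChartFlow

end

/-! ### Cotangent lifts are symplectic and preserve Hamilton vector fields -/

section CotangentLift

set_option synthInstance.maxHeartbeats 200000

variable {E : Type u} [NormedAddCommGroup E] [NormedSpace ℝ E]

/-- The function `(x, ξ) ↦ ξ(A(x) ξ) / 2 + v(x)` on phase space. -/
def coordHamiltonian (A : E → (E →L[ℝ] ℝ) →L[ℝ] E) (v : E → ℝ) (z : E × (E →L[ℝ] ℝ)) : ℝ :=
  (1 / 2) * z.2 (A z.1 z.2) + v z.1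

theorem hasFDerivAt_apply_apply {X F Y : Type*} [NormedAddCommGroup X] [NormedSpace ℝ X]
    [NormedAddCommGroup F] [NormedSpace ℝ F] [NormedAddCommGroup Y] [NormedSpace ℝ Y]
    {B : X → F →L[ℝ] Y} {B' : X →L[ℝ] F →L[ℝ] Y} {z : X × F} (hB : HasFDerivAt B B' z.1) :
    HasFDerivAt (fun z : X × F ↦ B z.1 z.2)
      (B z.1 ∘L ContinuousLinearMap.snd ℝ X F + (B'.flip z.2) ∘L ContinuousLinearMap.fst ℝ X F)
      z := by
  have h1 : HasFDerivAt (fun z : X × F ↦ B z.1) (B' ∘L ContinuousLinearMap.fst ℝ X F) z :=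
    HasFDerivAt.comp z hB hasFDerivAt_fst
  have h2 := h1.clm_apply (hasFDerivAt_snd (𝕜 := ℝ) (p := z))
  convert! h2 using 1

theorem fderiv_coordHamiltonian {A : E → (E →L[ℝ] ℝ) →L[ℝ] E} {v : E → ℝ}
    {z : E × (E →L[ℝ] ℝ)} (hA : DifferentiableAt ℝ A z.1) (hv : DifferentiableAt ℝ v z.1)
    (hsymm : ∀ η η' : E →L[ℝ] ℝ, η (A z.1 η') = η' (A z.1 η)) :
    HasFDerivAt (coordHamiltonian A v)
      (fderiv ℝ (coordHamiltonian A v) z) z ∧ ∀ w,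
    fderiv ℝ (coordHamiltonian A v) z w =
      w.2 (A z.1 z.2) + (1 / 2) * z.2 (fderiv ℝ A z.1 w.1 z.2) + fderiv ℝ v z.1 w.1 := by
  have h1 := hasFDerivAt_apply_apply hA.hasFDerivAt
  have h2 := (hasFDerivAt_snd (𝕜 := ℝ) (p := z)).clm_apply h1
  have h3 : HasFDerivAt (fun z : E × (E →L[ℝ] ℝ) ↦ v z.1)
      (fderiv ℝ v z.1 ∘L ContinuousLinearMap.fst ℝ E (E →L[ℝ] ℝ)) z :=
    HasFDerivAt.comp z hv.hasFDerivAt hasFDerivAt_fst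
  have h4 := (h2.const_mul (1 / 2)).add h3
  have h5 : HasFDerivAt (coordHamiltonian A v) _ z := h4
  refine ⟨h5.differentiableAt.hasFDerivAt, fun w ↦ ?_⟩
  rw [h5.fderiv]
  simp
  rw [hsymm z.2 w.2]
  ring

/-- Nondegeneracy of the symplectic form: pairing with vertical vectors `(0, η)` determines the
position component, pairing with horizontal vectors `(a, 0)` the momentum component. -/
theorem eq_hamiltonField_iff {A : E → (E →L[ℝ] ℝ) →L[ℝ] E} {v : E → ℝ}
    {z : E × (E →L[ℝ] ℝ)} (hA : DifferentiableAt ℝ A z.1) (hv : DifferentiableAt ℝ v z.1)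
    (hsymm : ∀ η η' : E →L[ℝ] ℝ, η (A z.1 η') = η' (A z.1 η)) {X : E × (E →L[ℝ] ℝ)} :
    (∀ w : E × (E →L[ℝ] ℝ), w.2 X.1 - X.2 w.1 = fderiv ℝ (coordHamiltonian A v) z w) ↔
      X = hamiltonField A v 1 z := by
  have hd := (fderiv_coordHamiltonian hA hv hsymm).2
  constructor
  · intro h
    refine Prod.ext ?_ ?_
    · refine (SeparatingDual.eq_iff_forall_dual_eq (R := ℝ)).2 fun η ↦ ?_
      simpa [hd, hamiltonField] using h (0, η)
    · ext a
      have := h (a, 0)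
      simp [hd] at this
      simp [hamiltonField]
      linarith
  · rintro rfl w
    simp [hd, hamiltonField]
    ring

/-- The cotangent lift of a diffeomorphism with inverse `χ`. -/
def cotangentLift (φ χ : E → E) (z : E × (E →L[ℝ] ℝ)) : E × (E →L[ℝ] ℝ) :=
  (φ z.1, z.2 ∘L fderiv ℝ χ (φ z.1))

/-- In the symplectic pairing, the terms containing the second derivative of `χ` cancel by its
symmetry; the rest is the chain rule for `χ ∘ φ = id`. -/
theorem exists_hasFDerivAt_cotangentLift {φ χ : E → E} {z : E × (E →L[ℝ] ℝ)}
    (hφ : ContDiffAt ℝ ∞ φ z.1) (hχ : ContDiffAt ℝ ∞ χ (φ z.1))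
    (h1 : χ ∘ φ =ᶠ[𝓝 z.1] id) (h2 : φ ∘ χ =ᶠ[𝓝 (φ z.1)] id) :
    ∃ D : (E × (E →L[ℝ] ℝ)) →L[ℝ] E × (E →L[ℝ] ℝ), HasFDerivAt (cotangentLift φ χ) D z ∧
      Function.Surjective D ∧ ∀ a b, (D b).2 (D a).1 - (D a).2 (D b).1 = b.2 a.1 - a.2 b.1 := by
  have hφd := (hφ.differentiableAt (by simp)).hasFDerivAt
  have hχd := (hχ.differentiableAt (by simp)).hasFDerivAt
  have hχ1 : ContDiffAt ℝ ∞ (fderiv ℝ χ) (φ z.1) := hχ.fderiv_right (by simp)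
  have hχdd := (hχ1.differentiableAt (by simp)).hasFDerivAt
  have hsym : IsSymmSndFDerivAt ℝ χ (φ z.1) :=
    hχ.isSymmSndFDerivAt (by
      rw [minSmoothness_of_isRCLikeNormedField]
      exact WithTop.coe_le_coe.2 (le_top : (2 : ℕ∞) ≤ ⊤))
  have hφ1 : HasFDerivAt (fun z : E × (E →L[ℝ] ℝ) ↦ φ z.1)
      (fderiv ℝ φ z.1 ∘L ContinuousLinearMap.fst ℝ E (E →L[ℝ] ℝ)) z :=
    HasFDerivAt.comp z hφd hasFDerivAt_fst
  have hχ2 : HasFDerivAt (fun z : E × (E →L[ℝ] ℝ) ↦ fderiv ℝ χ (φ z.1))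
      (fderiv ℝ (fderiv ℝ χ) (φ z.1) ∘L
        (fderiv ℝ φ z.1 ∘L ContinuousLinearMap.fst ℝ E (E →L[ℝ] ℝ))) z :=
    HasFDerivAt.comp z hχdd hφ1
  have hD := hφ1.prodMk ((hasFDerivAt_snd (𝕜 := ℝ) (p := z)).clm_comp hχ2)
  have hχφ : ∀ a, fderiv ℝ χ (φ z.1) (fderiv ℝ φ z.1 a) = a := by
    intro a
    have := (hχd.comp z.1 hφd).congr_of_eventuallyEq h1.symm
    exact DFunLike.congr_fun (this.unique (hasFDerivAt_id z.1)) a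
  have hφχ : ∀ a, fderiv ℝ φ z.1 (fderiv ℝ χ (φ z.1) a) = a := by
    intro a
    have hz : χ (φ z.1) = z.1 := h1.self_of_nhds
    have hφd' : HasFDerivAt φ (fderiv ℝ φ z.1) (χ (φ z.1)) := by rwa [hz]
    have := (hφd'.comp (φ z.1) hχd).congr_of_eventuallyEq h2.symm
    exact DFunLike.congr_fun (this.unique (hasFDerivAt_id (φ z.1))) a
  refine ⟨_, hD, fun w ↦ ⟨(fderiv ℝ χ (φ z.1) w.1,
    (w.2 - z.2 ∘L fderiv ℝ (fderiv ℝ χ) (φ z.1) w.1) ∘L fderiv ℝ φ z.1), ?_⟩, fun a b ↦ ?_⟩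
  · refine Prod.ext ?_ ?_
    · simp [hφχ]
    · ext c
      simp [hφχ]
  · simp [hχφ, hsym.eq (fderiv ℝ φ z.1 a.1) (fderiv ℝ φ z.1 b.1)]

/-- Hamilton vector fields are natural under cotangent lifts. -/
theorem exists_hasFDerivAt_cotangentLift_hamiltonField {φ χ : E → E} {z : E × (E →L[ℝ] ℝ)}
    (hφ : ContDiffAt ℝ ∞ φ z.1) (hχ : ContDiffAt ℝ ∞ χ (φ z.1))
    (h1 : χ ∘ φ =ᶠ[𝓝 z.1] id) (h2 : φ ∘ χ =ᶠ[𝓝 (φ z.1)] id)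
    {A₁ A₂ : E → (E →L[ℝ] ℝ) →L[ℝ] E} {v₁ v₂ : E → ℝ}
    (hA₁ : DifferentiableAt ℝ A₁ z.1) (hv₁ : DifferentiableAt ℝ v₁ z.1)
    (hsymm₁ : ∀ η η' : E →L[ℝ] ℝ, η (A₁ z.1 η') = η' (A₁ z.1 η))
    (hA₂ : DifferentiableAt ℝ A₂ (φ z.1)) (hv₂ : DifferentiableAt ℝ v₂ (φ z.1))
    (hsymm₂ : ∀ η η' : E →L[ℝ] ℝ, η (A₂ (φ z.1) η') = η' (A₂ (φ z.1) η))
    (hH : coordHamiltonian A₁ v₁ =ᶠ[𝓝 z] coordHamiltonian A₂ v₂ ∘ cotangentLift φ χ) :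
    ∃ D : (E × (E →L[ℝ] ℝ)) →L[ℝ] E × (E →L[ℝ] ℝ), HasFDerivAt (cotangentLift φ χ) D z ∧
      D (hamiltonField A₁ v₁ 1 z) = hamiltonField A₂ v₂ 1 (cotangentLift φ χ z) := by
  obtain ⟨D, hD, hsurj, hsympl⟩ := exists_hasFDerivAt_cotangentLift hφ hχ h1 h2
  refine ⟨D, hD, (eq_hamiltonField_iff (z := cotangentLift φ χ z) hA₂ hv₂ hsymm₂).1 fun w ↦ ?_⟩
  -- By surjectivity of `D` it suffices to test on vectors `D w`, where symplecticity moves the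
  -- identity back to `z`.
  obtain ⟨w, rfl⟩ := hsurj w
  have h3 := (fderiv_coordHamiltonian (z := cotangentLift φ χ z) hA₂ hv₂ hsymm₂).1.comp z hD
  have h4 := h3.congr_of_eventuallyEq hH
  rw [hsympl, (eq_hamiltonField_iff hA₁ hv₁ hsymm₁).2 rfl w, h4.fderiv]
  rfl

end CotangentLift

/-! ### Canonical charts of the cotangent bundle -/

section CotangentCharts

variable {E : Type u} [NormedAddCommGroup E] [NormedSpace ℝ E]
  {M : Type*} [TopologicalSpace M] [ChartedSpace E M] [IsManifold 𝓘(ℝ, E) ∞ M]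

/-- The canonical chart of `T*M` induced by the preferred chart of `M` at `y`. -/
def coChart (E : Type u) [NormedAddCommGroup E] [NormedSpace ℝ E] {M : Type*} [TopologicalSpace M]
    [ChartedSpace E M] [IsManifold 𝓘(ℝ, E) ∞ M] (y : M) :
    PartialEquiv (CotangentBundle E M) (E × (E →L[ℝ] ℝ)) :=
  extChartAt (cotangentModel E) (⟨y, 0⟩ : CotangentBundle E M)

/-- The coordinate representation of tangent vectors in the preferred chart at `y`, inverted. -/
def tangentSymm (y x : M) : E →L[ℝ] TangentSpace 𝓘(ℝ, E) x :=
  (trivializationAt E (TangentSpace 𝓘(ℝ, E)) y).symmL ℝ x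

/-- The representation of tangent vectors at `x` in the preferred chart at `y`. -/
def tangentCoord (y x : M) : TangentSpace 𝓘(ℝ, E) x →L[ℝ] E :=
  (trivializationAt E (TangentSpace 𝓘(ℝ, E)) y).continuousLinearMapAt ℝ x

theorem tangentSymm_tangentCoord {y x : M} (hx : x ∈ (chartAt E y).source)
    (v : TangentSpace 𝓘(ℝ, E) x) : tangentSymm y x (tangentCoord y x v) = v :=
  (trivializationAt E (TangentSpace 𝓘(ℝ, E)) y).symmL_continuousLinearMapAt hx v

theorem tangentCoord_tangentSymm {y x : M} (hx : x ∈ (chartAt E y).source) (v : E) :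
    tangentCoord y x (tangentSymm y x v) = v :=
  (trivializationAt E (TangentSpace 𝓘(ℝ, E)) y).continuousLinearMapAt_symmL hx v

theorem coChart_apply (y : M) (p : CotangentBundle E M) :
    coChart E y p = (extChartAt 𝓘(ℝ, E) y p.proj, p.2 ∘L tangentSymm y p.proj) := by
  refine Prod.ext rfl ?_
  change ContinuousLinearMap.inCoordinates E (TangentSpace 𝓘(ℝ, E)) ℝ (Trivial M ℝ) y p.proj y
    p.proj p.2 = _
  ext v
  simp [ContinuousLinearMap.inCoordinates, tangentSymm]

theorem coChart_source (y : M) :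
    (coChart E y).source = {p : CotangentBundle E M | p.proj ∈ (chartAt E y).source} := by
  ext p
  simp [coChart, extChartAt, FiberBundle.chartedSpace_chartAt, hom_trivializationAt_source]
  exact fun h ↦ h

theorem coChart_target (y : M) :
    (coChart E y).target = (extChartAt 𝓘(ℝ, E) y).target ×ˢ univ := by
  ext p
  simp [coChart, extChartAt, FiberBundle.chartedSpace_chartAt]
  exact ⟨fun h ↦ h.1.1, fun h ↦ ⟨⟨h, mem_univ _⟩, (chartAt E y).map_target h⟩⟩

theorem isOpen_coChart_source (y : M) : IsOpen (coChart E y).source := isOpen_extChartAt_source _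

theorem isOpen_coChart_target (y : M) : IsOpen (coChart E y (M := M)).target :=
  isOpen_extChartAt_target _

/-- This is the cocycle rule of the tangent bundle; it identifies changes of canonical charts with
cotangent lifts. -/
theorem tangentSymm_comp_fderiv {y₁ y₂ x : M} (h₁ : x ∈ (chartAt E y₁).source)
    (h₂ : x ∈ (chartAt E y₂).source) :
    tangentSymm y₁ x ∘L fderiv ℝ (extChartAt 𝓘(ℝ, E) y₁ ∘ (extChartAt 𝓘(ℝ, E) y₂).symm)
      (extChartAt 𝓘(ℝ, E) y₂ x) = tangentSymm y₂ x := by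
  ext v
  have h := tangentCoordChange_comp (I := 𝓘(ℝ, E)) (w := y₂) (x := y₁) (y := x) (z := x) (v := v)
    ⟨⟨by simpa using h₂, by simpa using h₁⟩, by simp⟩
  rw [tangentCoordChange_def (y := y₁), modelWithCornersSelf_coe, range_id, fderivWithin_univ] at h
  rw [tangentSymm, tangentSymm, TangentBundle.symmL_trivializationAt_eq_core h₁,
    TangentBundle.symmL_trivializationAt_eq_core h₂]
  exact h

end CotangentCharts

/-! ### The metric and the dual metric in coordinates -/

section Metric

set_option synthInstance.maxHeartbeats 200000

variable {E : Type u} [NormedAddCommGroup E] [NormedSpace ℝ E]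
  {M : Type*} [TopologicalSpace M] [ChartedSpace E M] [IsManifold 𝓘(ℝ, E) ∞ M]
  [RiemannianBundle (fun x : M ↦ TangentSpace 𝓘(ℝ, E) x)]

/-- The coefficients of the metric in the preferred chart at `y`, at the point of coordinates
`z`. -/
def coordMetric (E : Type u) [NormedAddCommGroup E] [NormedSpace ℝ E]
    {M : Type*} [TopologicalSpace M] [ChartedSpace E M] [IsManifold 𝓘(ℝ, E) ∞ M]
    [RiemannianBundle (fun x : M ↦ TangentSpace 𝓘(ℝ, E) x)] (y : M) (z : E) :
    E →L[ℝ] E →L[ℝ] ℝ :=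
  ((innerSL ℝ : TangentSpace 𝓘(ℝ, E) ((extChartAt 𝓘(ℝ, E) y).symm z) →L[ℝ]
    TangentSpace 𝓘(ℝ, E) ((extChartAt 𝓘(ℝ, E) y).symm z) →L[ℝ] ℝ)).bilinearComp
      (tangentSymm y ((extChartAt 𝓘(ℝ, E) y).symm z))
      (tangentSymm y ((extChartAt 𝓘(ℝ, E) y).symm z))

theorem coordMetric_apply (y : M) (z v w : E) :
    coordMetric E y z v w = inner ℝ (tangentSymm y ((extChartAt 𝓘(ℝ, E) y).symm z) v)
      (tangentSymm y ((extChartAt 𝓘(ℝ, E) y).symm z) w) := rfl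

omit [RiemannianBundle (fun x : M ↦ TangentSpace 𝓘(ℝ, E) x)] in
theorem contMDiffOn_tangentSymm (y : M) (v : E) :
    ContMDiffOn 𝓘(ℝ, E) (𝓘(ℝ, E).prod 𝓘(ℝ, E)) ∞
      (fun x ↦ (⟨x, tangentSymm y x v⟩ : TangentBundle 𝓘(ℝ, E) M)) (chartAt E y).source := by
  have h := ((trivializationAt E (TangentSpace 𝓘(ℝ, E)) y).contMDiffOn_symm
    (IB := 𝓘(ℝ, E)) (n := ∞)).comp (s := (chartAt E y).source)
    (contMDiffOn_id.prodMk (contMDiffOn_const (c := v))) (fun x hx ↦ by simpa using hx)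
  refine h.congr fun x hx ↦ ?_
  simp only [Function.comp, id]
  rw [← Trivialization.mk_symm _ hx]
  exact congrArg _ (Trivialization.symmL_apply (R := ℝ) _ hx _)

variable [IsContMDiffRiemannianBundle 𝓘(ℝ, E) ∞ E (fun x : M ↦ TangentSpace 𝓘(ℝ, E) x)]

/-- In finite dimension smoothness can be checked on fixed vectors, where the coefficient is the
inner product of two smooth local sections. -/
theorem contDiffOn_coordMetric [FiniteDimensional ℝ E] (y : M) :
    ContDiffOn ℝ ∞ (coordMetric E y) (extChartAt 𝓘(ℝ, E) y).target := by
  refine contDiffOn_clm_apply.2 fun v ↦ contDiffOn_clm_apply.2 fun w ↦ ?_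
  have h : ContMDiffOn 𝓘(ℝ, E) 𝓘(ℝ, ℝ) ∞
      (fun x : M ↦ inner ℝ (tangentSymm (E := E) y x v) (tangentSymm (E := E) y x w))
      (chartAt E y).source :=
    ContMDiffOn.inner_bundle (contMDiffOn_tangentSymm y v) (contMDiffOn_tangentSymm y w)
  rw [← contMDiffOn_iff_contDiffOn]
  exact h.comp (contMDiffOn_extChartAt_symm y) fun z hz ↦ by
    simpa using (extChartAt 𝓘(ℝ, E) y).map_target hz

omit [IsContMDiffRiemannianBundle 𝓘(ℝ, E) ∞ E (fun x : M ↦ TangentSpace 𝓘(ℝ, E) x)]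

theorem coordMetric_extChartAt {y x : M} (hx : x ∈ (chartAt E y).source) (v w : E) :
    coordMetric E y (extChartAt 𝓘(ℝ, E) y x) v w =
      inner ℝ (tangentSymm y x v) (tangentSymm y x w) := by
  rw [coordMetric_apply, (extChartAt 𝓘(ℝ, E) y).left_inv (by simpa using hx)]

theorem coordMetric_symm (y : M) (z v w : E) :
    coordMetric E y z v w = coordMetric E y z w v := by
  rw [coordMetric_apply, coordMetric_apply, real_inner_comm]

theorem coordMetric_injective {y : M} {z : E} (hz : z ∈ (extChartAt 𝓘(ℝ, E) y).target) :
    Function.Injective (coordMetric E y z) := by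
  refine (injective_iff_map_eq_zero _).2 fun v hv ↦ ?_
  have hx : (extChartAt 𝓘(ℝ, E) y).symm z ∈ (chartAt E y).source := by
    simpa using (extChartAt 𝓘(ℝ, E) y).map_target hz
  have h1 : coordMetric E y z v v = 0 := by rw [hv]; rfl
  rw [coordMetric_apply, inner_self_eq_zero] at h1
  rw [← tangentCoord_tangentSymm hx v, h1, map_zero]

variable [FiniteDimensional ℝ E]

omit [RiemannianBundle (fun x : M ↦ TangentSpace 𝓘(ℝ, E) x)] [IsManifold 𝓘(ℝ, E) ∞ M]
  [ChartedSpace E M] [TopologicalSpace M] in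
theorem isInvertible_of_injective_dual {B : E →L[ℝ] E →L[ℝ] ℝ} (hB : Function.Injective B) :
    B.IsInvertible := by
  have hrank : Module.finrank ℝ E = Module.finrank ℝ (E →L[ℝ] ℝ) := by
    rw [← (LinearMap.toContinuousLinearMap (𝕜 := ℝ) (E := E) (F' := ℝ)).finrank_eq]
    exact Subspace.dual_finrank_eq.symm
  exact ⟨(LinearMap.linearEquivOfInjective B.toLinearMap hB hrank).toContinuousLinearEquiv, by
    ext; rfl⟩

/-- The coefficients of the dual metric in the preferred chart at `y`. -/
def cometric (E : Type u) [NormedAddCommGroup E] [NormedSpace ℝ E]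
    {M : Type*} [TopologicalSpace M] [ChartedSpace E M] [IsManifold 𝓘(ℝ, E) ∞ M]
    [RiemannianBundle (fun x : M ↦ TangentSpace 𝓘(ℝ, E) x)] (y : M) (z : E) :
    (E →L[ℝ] ℝ) →L[ℝ] E :=
  (coordMetric E y z).inverse

theorem coordMetric_cometric {y : M} {z : E} (hz : z ∈ (extChartAt 𝓘(ℝ, E) y).target)
    (η : E →L[ℝ] ℝ) : coordMetric E y z (cometric E y z η) = η :=
  (isInvertible_of_injective_dual (coordMetric_injective hz)).self_apply_inverse η

theorem cometric_injective {y : M} {z : E} (hz : z ∈ (extChartAt 𝓘(ℝ, E) y).target) :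
    Function.Injective (cometric E y z) :=
  Function.LeftInverse.injective (coordMetric_cometric hz)

theorem cometric_symm {y : M} {z : E} (hz : z ∈ (extChartAt 𝓘(ℝ, E) y).target)
    (η η' : E →L[ℝ] ℝ) : η (cometric E y z η') = η' (cometric E y z η) := by
  conv_lhs => rw [← coordMetric_cometric hz η]
  conv_rhs => rw [← coordMetric_cometric hz η']
  exact coordMetric_symm y z _ _

theorem contDiffOn_cometric
    [IsContMDiffRiemannianBundle 𝓘(ℝ, E) ∞ E (fun x : M ↦ TangentSpace 𝓘(ℝ, E) x)] (y : M) :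
    ContDiffOn ℝ ∞ (cometric E y) (extChartAt 𝓘(ℝ, E) y).target := by
  have : CompleteSpace E := FiniteDimensional.complete ℝ E
  intro z hz
  exact (isInvertible_of_injective_dual
    (coordMetric_injective hz)).contDiffAt_map_inverse.comp_contDiffWithinAt z
      (contDiffOn_coordMetric y z hz)

/-- The norm of a covector and of its dual tangent vector, in coordinates. -/
theorem norm_tangentSymm_cometric {y : M} {p : CotangentBundle E M}
    (hp : p.proj ∈ (chartAt E y).source) :
    momentumNorm p ^ 2 = (coChart E y p).2 (cometric E y (coChart E y p).1 (coChart E y p).2) ∧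
      ‖tangentSymm y p.proj (cometric E y (coChart E y p).1 (coChart E y p).2)‖ ^ 2 =
        momentumNorm p ^ 2 := by
  obtain ⟨x, ξ⟩ := p
  rw [coChart_apply]
  simp only at hp ⊢
  set η : E →L[ℝ] ℝ := ξ ∘L tangentSymm y x
  set u := tangentSymm y x (cometric E y (extChartAt 𝓘(ℝ, E) y x) η)
  have hz : extChartAt 𝓘(ℝ, E) y x ∈ (extChartAt 𝓘(ℝ, E) y).target :=
    (extChartAt 𝓘(ℝ, E) y).map_source (by simpa using hp)
  -- The vector `u` is the Riesz representative of `ξ`, so the norms of `u` and `ξ` agree.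
  have hu : ∀ v, inner ℝ u v = ξ v := by
    intro v
    have h1 := coordMetric_extChartAt hp (cometric E y (extChartAt 𝓘(ℝ, E) y x) η)
      (tangentCoord y x v)
    rw [coordMetric_cometric hz, tangentSymm_tangentCoord hp] at h1
    rw [← h1]
    change ξ (tangentSymm y x (tangentCoord y x v)) = ξ v
    rw [tangentSymm_tangentCoord hp]
  have hξ : innerSL ℝ u = ξ := ContinuousLinearMap.ext hu
  have h1 : momentumNorm (⟨x, ξ⟩ : CotangentBundle E M) = ‖u‖ := by
    rw [momentumNorm, ← innerSL_apply_norm (𝕜 := ℝ) u, hξ]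
  have h2 : ‖u‖ ^ 2 = η (cometric E y (extChartAt 𝓘(ℝ, E) y x) η) := by
    rw [← real_inner_self_eq_norm_sq, hu]
    rfl
  rw [h1]
  exact ⟨h2, rfl⟩

end Metric

/-! ### The Hamilton equations in charts and their invariance -/

section ChartSolution

set_option synthInstance.maxHeartbeats 200000

variable {E : Type u} [NormedAddCommGroup E] [NormedSpace ℝ E]
  {M : Type*} [TopologicalSpace M] [ChartedSpace E M] [IsManifold 𝓘(ℝ, E) ∞ M]

theorem tangentSymm_self (x : M) (v : E) : tangentSymm (E := E) x x v = v := by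
  rw [tangentSymm, TangentBundle.symmL_trivializationAt_eq_core (mem_chart_source E x)]
  exact (tangentBundleCore 𝓘(ℝ, E) M).coordChange_self _ _ (mem_chart_source E x) v

theorem coChart_symm_proj {y : M} {z : E × (E →L[ℝ] ℝ)} (hz : z ∈ (coChart E y (M := M)).target) :
    ((coChart E y).symm z).proj = (extChartAt 𝓘(ℝ, E) y).symm z.1 := by
  have h1 := (coChart E y (M := M)).map_target hz
  have h2 := (coChart E y (M := M)).right_inv hz
  rw [coChart_source] at h1
  rw [coChart_apply] at h2
  rw [← h2, (extChartAt 𝓘(ℝ, E) y).left_inv (by simpa using h1), h2]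

/-- The potential in the preferred chart at `y`. -/
def coordPotential (E : Type u) [NormedAddCommGroup E] [NormedSpace ℝ E] {M : Type*}
    [TopologicalSpace M] [ChartedSpace E M] (V : M → ℝ) (y : M) : E → ℝ :=
  V ∘ (extChartAt 𝓘(ℝ, E) y).symm

theorem contDiffOn_coordPotential {V : M → ℝ} (hV : ContMDiff 𝓘(ℝ, E) 𝓘(ℝ, ℝ) ∞ V) (y : M) :
    ContDiffOn ℝ ∞ (coordPotential E V y) (extChartAt 𝓘(ℝ, E) y).target := by
  rw [← contMDiffOn_iff_contDiffOn]
  exact hV.comp_contMDiffOn (contMDiffOn_extChartAt_symm y)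

variable [RiemannianBundle (fun x : M ↦ TangentSpace 𝓘(ℝ, E) x)]

/-- The Hamilton vector field in the preferred chart at `y`. -/
def chartField (V : M → ℝ) (y : M) : E × (E →L[ℝ] ℝ) → E × (E →L[ℝ] ℝ) :=
  hamiltonField (cometric E y) (coordPotential E V y) 1

variable [FiniteDimensional ℝ E]

theorem hamiltonian_eq_coordHamiltonian (V : M → ℝ) {y : M} {p : CotangentBundle E M}
    (hp : p.proj ∈ (chartAt E y).source) :
    hamiltonian V p =
      coordHamiltonian (cometric E y) (coordPotential E V y) (coChart E y p) := by
  rw [hamiltonian, coordHamiltonian, (norm_tangentSymm_cometric hp).1]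
  simp only [coChart_apply, coordPotential, Function.comp]
  rw [(extChartAt 𝓘(ℝ, E) y).left_inv (by simpa using hp)]

variable [IsContMDiffRiemannianBundle 𝓘(ℝ, E) ∞ E (fun x : M ↦ TangentSpace 𝓘(ℝ, E) x)]
  {V : M → ℝ}

theorem differentiableAt_cometric {y x : M} (hx : x ∈ (chartAt E y).source) :
    DifferentiableAt ℝ (cometric E y) (extChartAt 𝓘(ℝ, E) y x) :=
  ((contDiffOn_cometric y).contDiffAt ((isOpen_extChartAt_target y).mem_nhds
    ((extChartAt 𝓘(ℝ, E) y).map_source (by simpa using hx)))).differentiableAt (by simp)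

omit [FiniteDimensional ℝ E] [RiemannianBundle (fun x : M ↦ TangentSpace 𝓘(ℝ, E) x)]
  [IsContMDiffRiemannianBundle 𝓘(ℝ, E) ∞ E (fun x : M ↦ TangentSpace 𝓘(ℝ, E) x)] in
theorem differentiableAt_coordPotential (hV : ContMDiff 𝓘(ℝ, E) 𝓘(ℝ, ℝ) ∞ V) {y x : M}
    (hx : x ∈ (chartAt E y).source) :
    DifferentiableAt ℝ (coordPotential E V y) (extChartAt 𝓘(ℝ, E) y x) :=
  ((contDiffOn_coordPotential hV y).contDiffAt ((isOpen_extChartAt_target y).mem_nhds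
    ((extChartAt 𝓘(ℝ, E) y).map_source (by simpa using hx)))).differentiableAt (by simp)

/-- The transition map is the cotangent lift of the coordinate change, and both coordinate
Hamiltonians represent the same function on `T*M`, so naturality of Hamilton fields applies. -/
theorem exists_hasFDerivAt_coChart_transition (hV : ContMDiff 𝓘(ℝ, E) 𝓘(ℝ, ℝ) ∞ V) {y₁ y₂ : M}
    {q : CotangentBundle E M} (h₁ : q.proj ∈ (chartAt E y₁).source)
    (h₂ : q.proj ∈ (chartAt E y₂).source) :
    ∃ D : (E × (E →L[ℝ] ℝ)) →L[ℝ] E × (E →L[ℝ] ℝ),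
      HasFDerivAt (coChart E y₂ ∘ (coChart E y₁).symm) D (coChart E y₁ q) ∧
      D (chartField V y₁ (coChart E y₁ q)) = chartField V y₂ (coChart E y₂ q) := by
  set φ := extChartAt 𝓘(ℝ, E) y₂ ∘ (extChartAt 𝓘(ℝ, E) y₁).symm
  set χ := extChartAt 𝓘(ℝ, E) y₁ ∘ (extChartAt 𝓘(ℝ, E) y₂).symm
  have key : ∀ {p : CotangentBundle E M}, p.proj ∈ (chartAt E y₁).source →
      p.proj ∈ (chartAt E y₂).source → cotangentLift φ χ (coChart E y₁ p) = coChart E y₂ p := by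
    intro p hp₁ hp₂
    have hφ : φ (extChartAt 𝓘(ℝ, E) y₁ p.proj) = extChartAt 𝓘(ℝ, E) y₂ p.proj := by
      simp only [φ, Function.comp]
      rw [(extChartAt 𝓘(ℝ, E) y₁).left_inv (by simpa using hp₁)]
    rw [coChart_apply, coChart_apply, cotangentLift, hφ, ← tangentSymm_comp_fderiv hp₁ hp₂]
    rfl
  have hev : ∀ᶠ z in 𝓝 (coChart E y₁ q), ∃ p : CotangentBundle E M,
      p.proj ∈ (chartAt E y₁).source ∧ p.proj ∈ (chartAt E y₂).source ∧
      (coChart E y₁).symm z = p ∧ z = coChart E y₁ p := by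
    have hq : q ∈ (coChart E y₁).source := by rwa [coChart_source]
    have ho : IsOpen ((coChart E y₁).target ∩ (coChart E y₁).symm ⁻¹' (coChart E y₂).source) :=
      (continuousOn_extChartAt_symm _).isOpen_inter_preimage (isOpen_coChart_target y₁)
        (isOpen_coChart_source y₂)
    filter_upwards [ho.mem_nhds ⟨(coChart E y₁).map_source hq, by
      rwa [mem_preimage, (coChart E y₁).left_inv hq, coChart_source]⟩] with z hz
    refine ⟨(coChart E y₁).symm z, ?_, ?_, rfl, ((coChart E y₁).right_inv hz.1).symm⟩
    · simpa [coChart_source] using (coChart E y₁ (M := M)).map_target hz.1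
    · simpa [coChart_source] using hz.2
  have hφs : extChartAt 𝓘(ℝ, E) y₁ q.proj ∈
      ((extChartAt 𝓘(ℝ, E) y₁).symm ≫ extChartAt 𝓘(ℝ, E) y₂).source := by
    simp [PartialEquiv.trans_source, h₁, h₂]
  have hχs : extChartAt 𝓘(ℝ, E) y₂ q.proj ∈
      ((extChartAt 𝓘(ℝ, E) y₂).symm ≫ extChartAt 𝓘(ℝ, E) y₁).source := by
    simp [PartialEquiv.trans_source, h₁, h₂]
  have hφq : φ (coChart E y₁ q).1 = (coChart E y₂ q).1 := congrArg Prod.fst (key h₁ h₂)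
  have hφ : ContDiffAt ℝ ∞ φ (coChart E y₁ q).1 := by
    rw [coChart_apply, ← contDiffWithinAt_univ]
    have := contDiffWithinAt_ext_coord_change (I := 𝓘(ℝ, E)) (n := ∞) y₂ y₁ hφs
    rwa [modelWithCornersSelf_coe, range_id] at this
  have hχ : ContDiffAt ℝ ∞ χ (φ (coChart E y₁ q).1) := by
    rw [hφq, coChart_apply, ← contDiffWithinAt_univ]
    have := contDiffWithinAt_ext_coord_change (I := 𝓘(ℝ, E)) (n := ∞) y₁ y₂ hχs
    rwa [modelWithCornersSelf_coe, range_id] at this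
  have hinv : ∀ {a b x : M}, x ∈ (chartAt E a).source → x ∈ (chartAt E b).source →
      (extChartAt 𝓘(ℝ, E) a ∘ (extChartAt 𝓘(ℝ, E) b).symm) ∘
        (extChartAt 𝓘(ℝ, E) b ∘ (extChartAt 𝓘(ℝ, E) a).symm) =ᶠ[𝓝 (extChartAt 𝓘(ℝ, E) a x)] id := by
    intro a b x ha hb
    have ho : IsOpen ((extChartAt 𝓘(ℝ, E) a).target ∩
        (extChartAt 𝓘(ℝ, E) a).symm ⁻¹' (extChartAt 𝓘(ℝ, E) b).source) :=
      (continuousOn_extChartAt_symm _).isOpen_inter_preimage (isOpen_extChartAt_target a)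
        (isOpen_extChartAt_source b)
    filter_upwards [ho.mem_nhds ⟨(extChartAt 𝓘(ℝ, E) a).map_source (by simpa using ha), by
      rw [mem_preimage, (extChartAt 𝓘(ℝ, E) a).left_inv (by simpa using ha)]
      simpa using hb⟩] with z hz
    simp only [Function.comp, id]
    rw [(extChartAt 𝓘(ℝ, E) b).left_inv hz.2, (extChartAt 𝓘(ℝ, E) a).right_inv hz.1]
  have h1 := hinv (a := y₁) (b := y₂) h₁ h₂
  have h2 := hinv (a := y₂) (b := y₁) h₂ h₁
  obtain ⟨D, hD, hDX⟩ := exists_hasFDerivAt_cotangentLift_hamiltonField (φ := φ) (χ := χ)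
    (z := coChart E y₁ q) hφ hχ (by rw [coChart_apply]; exact h1)
    (by rw [hφq, coChart_apply]; exact h2)
    (A₁ := cometric E y₁) (A₂ := cometric E y₂) (v₁ := coordPotential E V y₁)
    (v₂ := coordPotential E V y₂) (by rw [coChart_apply]; exact differentiableAt_cometric h₁)
    (by rw [coChart_apply]; exact differentiableAt_coordPotential hV h₁)
    (by rw [coChart_apply]; exact cometric_symm ((extChartAt 𝓘(ℝ, E) y₁).map_source
      (by simpa using h₁)))
    (by rw [hφq, coChart_apply]; exact differentiableAt_cometric h₂)
    (by rw [hφq, coChart_apply]; exact differentiableAt_coordPotential hV h₂)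
    (by rw [hφq, coChart_apply]; exact cometric_symm ((extChartAt 𝓘(ℝ, E) y₂).map_source
      (by simpa using h₂)))
    (by
      filter_upwards [hev] with z ⟨p, hp₁, hp₂, _, hz⟩
      rw [hz, Function.comp_apply, key hp₁ hp₂, ← hamiltonian_eq_coordHamiltonian V hp₁,
        ← hamiltonian_eq_coordHamiltonian V hp₂])
  refine ⟨D, hD.congr_of_eventuallyEq ?_, by rw [← key h₁ h₂]; exact hDX⟩
  filter_upwards [hev] with z ⟨p, hp₁, hp₂, hs, hz⟩
  rw [Function.comp_apply, hs, hz, key hp₁ hp₂]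

/-- At time `s`, the curve `γ` on `[0, t]` solves the Hamilton equations in the preferred chart at
`y`. -/
def IsChartSolutionAt (V : M → ℝ) (y : M) (t : ℝ) (γ : ℝ → CotangentBundle E M) (s : ℝ) : Prop :=
  ContinuousWithinAt γ (Icc 0 t) s ∧
    HasDerivWithinAt (coChart E y ∘ γ) (chartField V y (coChart E y (γ s))) (Icc 0 t) s

/-- The chain rule with the transition map. The continuity clause of the definition keeps `γ` in the
first chart near `s`. -/
theorem IsChartSolutionAt.congr_chart (hV : ContMDiff 𝓘(ℝ, E) 𝓘(ℝ, ℝ) ∞ V) {y₁ y₂ : M} {t s : ℝ}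
    {γ : ℝ → CotangentBundle E M} (h₁ : (γ s).proj ∈ (chartAt E y₁).source)
    (h₂ : (γ s).proj ∈ (chartAt E y₂).source) (h : IsChartSolutionAt V y₁ t γ s) :
    IsChartSolutionAt V y₂ t γ s := by
  obtain ⟨D, hD, hDX⟩ := exists_hasFDerivAt_coChart_transition hV h₁ h₂
  refine ⟨h.1, ?_⟩
  have h3 := HasFDerivAt.comp_hasDerivWithinAt s (f := coChart E y₁ ∘ γ) hD h.2
  rw [hDX] at h3
  have hs : γ s ∈ (coChart E y₁).source := by rwa [coChart_source]
  refine h3.congr_of_eventuallyEq ?_ ?_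
  · filter_upwards [h.1.preimage_mem_nhdsWithin ((isOpen_coChart_source y₁).mem_nhds hs)] with r hr
    simp only [Function.comp]
    rw [(coChart E y₁).left_inv hr]
  · simp only [Function.comp]
    rw [(coChart E y₁).left_inv hs]

/-- The preferred chart of `T*M` at `p` depends only on the base point and equals `coChart E
p.proj`, so the manifold derivative at `p` is the ordinary derivative in that chart. -/
theorem isHamiltonVectorAt_iff (hV : ContMDiff 𝓘(ℝ, E) 𝓘(ℝ, ℝ) ∞ V) (p : CotangentBundle E M)
    (X : E × (E →L[ℝ] ℝ)) : IsHamiltonVectorAt (hamiltonian V) p X ↔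
      X = chartField V p.proj (coChart E p.proj p) := by
  have hx := mem_chart_source E p.proj
  have hp : p ∈ (coChart E p.proj).source := by rwa [coChart_source]
  have hA := differentiableAt_cometric hx
  have hv := differentiableAt_coordPotential hV hx
  have hs := cometric_symm (mem_extChartAt_target (I := 𝓘(ℝ, E)) p.proj)
  have hd := (fderiv_coordHamiltonian (z := coChart E p.proj p) hA hv hs).1
  have hH : HasMFDerivAt (cotangentModel E) 𝓘(ℝ, ℝ) (hamiltonian V) p
      (fderiv ℝ (coordHamiltonian (cometric E p.proj) (coordPotential E V p.proj))
        (coChart E p.proj p)) := by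
    constructor
    · have h1 : ContinuousAt (coordHamiltonian (cometric E p.proj) (coordPotential E V p.proj) ∘
          coChart E p.proj) p :=
        ContinuousAt.comp hd.continuousAt (continuousAt_extChartAt p)
      refine h1.congr ?_
      filter_upwards [(isOpen_coChart_source p.proj).mem_nhds hp] with q hq
      rw [coChart_source] at hq
      exact (hamiltonian_eq_coordHamiltonian V hq).symm
    · have h2 := hd.congr_of_eventuallyEq (f₁ := hamiltonian V ∘ (coChart E p.proj).symm) (by
        filter_upwards [(isOpen_coChart_target p.proj).mem_nhds
          ((coChart E p.proj).map_source hp)] with z hz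
        have h3 := (coChart E p.proj).map_target hz
        rw [coChart_source] at h3
        rw [Function.comp_apply, hamiltonian_eq_coordHamiltonian V h3,
          (coChart E p.proj).right_inv hz])
      exact h2.hasFDerivWithinAt
  rw [chartField, ← eq_hamiltonField_iff (z := coChart E p.proj p) hA hv hs]
  refine forall_congr' fun w ↦ ?_
  rw [hH.mfderiv]
  rfl

theorem isClassicalPath_iff_isChartSolutionAt_self (hV : ContMDiff 𝓘(ℝ, E) 𝓘(ℝ, ℝ) ∞ V) {t : ℝ}
    {γ : ℝ → CotangentBundle E M} : IsClassicalPath (hamiltonian V) t γ ↔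
      ∀ s ∈ Icc 0 t, IsChartSolutionAt V (γ s).proj t γ s := by
  refine forall₂_congr fun s hs ↦ ?_
  have h : ∀ X : E × (E →L[ℝ] ℝ), HasMFDerivWithinAt 𝓘(ℝ, ℝ) (cotangentModel E) γ (Icc 0 t) s
      (ContinuousLinearMap.toSpanSingleton ℝ X) ↔ ContinuousWithinAt γ (Icc 0 t) s ∧
        HasDerivWithinAt (coChart E (γ s).proj ∘ γ) X (Icc 0 t) s := by
    intro X
    change _ ∧ HasFDerivWithinAt (coChart E (γ s).proj ∘ γ)
      (ContinuousLinearMap.toSpanSingleton ℝ X) (id ⁻¹' Icc 0 t ∩ range id) s ↔ _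
    rw [preimage_id, range_id, inter_univ, hasDerivWithinAt_iff_hasFDerivWithinAt]
  constructor
  · rintro ⟨X, hX, hX'⟩
    have h1 := (h X).1 hX
    rwa [(isHamiltonVectorAt_iff hV _ _).1 hX'] at h1
  · intro hP
    exact ⟨_, (h _).2 hP, (isHamiltonVectorAt_iff hV _ _).2 rfl⟩

end ChartSolution

theorem contDiffOn_hamiltonField_const {E : Type*} [NormedAddCommGroup E] [NormedSpace ℝ E]
    {O : Set E} {A : E → (E →L[ℝ] ℝ) →L[ℝ] E} {v : E → ℝ} (hO : IsOpen O)
    (hA : ContDiffOn ℝ ∞ A O) (hv : ContDiffOn ℝ ∞ v O) (ε : ℝ) :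
    ContDiffOn ℝ ∞ (hamiltonField A v ε) {z | z.1 ∈ O} :=
  (contDiffOn_hamiltonField hO hA hv).comp (contDiff_const.prodMk contDiff_id).contDiffOn
    fun _ h ↦ h

/-! ### Classical paths: Legendre transform and uniqueness -/

section ClassicalPaths

set_option synthInstance.maxHeartbeats 200000

variable {E : Type u} [NormedAddCommGroup E] [NormedSpace ℝ E]
  {M : Type*} [TopologicalSpace M] [ChartedSpace E M] [IsManifold 𝓘(ℝ, E) ∞ M]
  [RiemannianBundle (fun x : M ↦ TangentSpace 𝓘(ℝ, E) x)]
  [FiniteDimensional ℝ E]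
  [IsContMDiffRiemannianBundle 𝓘(ℝ, E) ∞ E (fun x : M ↦ TangentSpace 𝓘(ℝ, E) x)]
  {V : M → ℝ}

theorem isClassicalPath_of_isChartSolutionAt (hV : ContMDiff 𝓘(ℝ, E) 𝓘(ℝ, ℝ) ∞ V) {y : M} {t : ℝ}
    {γ : ℝ → CotangentBundle E M}
    (h : ∀ s ∈ Icc 0 t, (γ s).proj ∈ (chartAt E y).source ∧ IsChartSolutionAt V y t γ s) :
    IsClassicalPath (hamiltonian V) t γ :=
  (isClassicalPath_iff_isChartSolutionAt_self hV).2 fun s hs ↦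
    (h s hs).2.congr_chart hV (h s hs).1 (mem_chart_source E _)

theorem IsClassicalPath.isChartSolutionAt (hV : ContMDiff 𝓘(ℝ, E) 𝓘(ℝ, ℝ) ∞ V) {y : M} {t s : ℝ}
    {γ : ℝ → CotangentBundle E M} (hγ : IsClassicalPath (hamiltonian V) t γ) (hs : s ∈ Icc 0 t)
    (hy : (γ s).proj ∈ (chartAt E y).source) : IsChartSolutionAt V y t γ s :=
  ((isClassicalPath_iff_isChartSolutionAt_self hV).1 hγ s hs).congr_chart hV
    (mem_chart_source E _) hy

/-- The Lagrangian along a classical path, by the Legendre transform. -/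
theorem IsClassicalPath.lagrangianAlong_eq (hV : ContMDiff 𝓘(ℝ, E) 𝓘(ℝ, ℝ) ∞ V) {t s : ℝ}
    (ht : 0 < t) {γ : ℝ → CotangentBundle E M} (hγ : IsClassicalPath (hamiltonian V) t γ)
    (hs : s ∈ Icc 0 t) :
    lagrangianAlong V t γ s = (1 / 2) * momentumNorm (γ s) ^ 2 - V (γ s).proj := by
  obtain ⟨h1, h2⟩ := hγ.isChartSolutionAt hV hs (mem_chart_source E _)
  set X : E := cometric E (γ s).proj (coChart E (γ s).proj (γ s)).1
    (coChart E (γ s).proj (γ s)).2 with hX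
  have h3 : HasDerivWithinAt (extChartAt 𝓘(ℝ, E) (γ s).proj ∘ fun r ↦ (γ r).proj) X
      (Icc 0 t) s := h2.fst
  have h4 : HasMFDerivWithinAt 𝓘(ℝ, ℝ) 𝓘(ℝ, E) (fun r ↦ (γ r).proj) (Icc 0 t) s
      (ContinuousLinearMap.toSpanSingleton ℝ X : ℝ →L[ℝ] E) := by
    refine ⟨(FiberBundle.continuous_proj _ _).continuousAt.comp_continuousWithinAt h1, ?_⟩
    change HasFDerivWithinAt (extChartAt 𝓘(ℝ, E) (γ s).proj ∘ fun r ↦ (γ r).proj)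
      (ContinuousLinearMap.toSpanSingleton ℝ X) (id ⁻¹' Icc 0 t ∩ range id) s
    rw [preimage_id, range_id, inter_univ, ← hasDerivWithinAt_iff_hasFDerivWithinAt]
    exact h3
  have h5 : (mfderivWithin 𝓘(ℝ, ℝ) 𝓘(ℝ, E) (fun r ↦ (γ r).proj) (Icc 0 t) s (1 : ℝ) :
      TangentSpace 𝓘(ℝ, E) (γ s).proj) = tangentSymm (γ s).proj (γ s).proj X := by
    rw [h4.mfderivWithin ((uniqueDiffOn_Icc ht).uniqueMDiffOn s hs), tangentSymm_self]
    exact one_smul ℝ X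
  rw [lagrangianAlong, h5, hX, (norm_tangentSymm_cometric (mem_chart_source E _)).2]

theorem contDiffOn_chartField (hV : ContMDiff 𝓘(ℝ, E) 𝓘(ℝ, ℝ) ∞ V) (y : M) :
    ContDiffOn ℝ ∞ (chartField V y) (coChart E y (M := M)).target :=
  (contDiffOn_hamiltonField_const (isOpen_extChartAt_target y) (contDiffOn_cometric y)
    (contDiffOn_coordPotential hV y) 1).mono fun z hz ↦ by
      rw [coChart_target] at hz
      exact hz.1

theorem IsClassicalPath.continuousOn (hV : ContMDiff 𝓘(ℝ, E) 𝓘(ℝ, ℝ) ∞ V) {t : ℝ}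
    {γ : ℝ → CotangentBundle E M} (hγ : IsClassicalPath (hamiltonian V) t γ) :
    ContinuousOn γ (Icc 0 t) := fun _ hs ↦
  (hγ.isChartSolutionAt hV hs (mem_chart_source E _)).1

omit [RiemannianBundle (fun x : M ↦ TangentSpace 𝓘(ℝ, E) x)]
  [IsContMDiffRiemannianBundle 𝓘(ℝ, E) ∞ E (fun x : M ↦ TangentSpace 𝓘(ℝ, E) x)]
  [FiniteDimensional ℝ E] in
-- Points of one fibre are separated in a canonical chart, points of different fibres by the
-- projection.
theorem t2Space_cotangentBundle [T2Space M] : T2Space (CotangentBundle E M) := by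
  refine ⟨fun p q hpq ↦ ?_⟩
  by_cases h : p.proj = q.proj
  · have hp : p ∈ (coChart E p.proj).source := by
      rw [coChart_source]
      exact mem_chart_source E p.proj
    have hq : q ∈ (coChart E p.proj).source := by
      rw [coChart_source, h]
      exact mem_chart_source E q.proj
    obtain ⟨u, v, hu, hv, hpu, hqv, huv⟩ :=
      t2_separation (fun h ↦ hpq ((coChart E p.proj).injOn hp hq h))
    have hc : ContinuousOn (coChart E p.proj) (coChart E p.proj).source :=
      continuousOn_extChartAt p
    exact ⟨_, _, hc.isOpen_inter_preimage (isOpen_coChart_source _) hu,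
      hc.isOpen_inter_preimage (isOpen_coChart_source _) hv, ⟨hp, hpu⟩, ⟨hq, hqv⟩,
      (huv.preimage _).mono inter_subset_right inter_subset_right⟩
  · exact separated_by_continuous (FiberBundle.continuous_proj _ _) h

/-- A classical path is determined by its initial point. -/
theorem IsClassicalPath.eqOn [T2Space M] (hV : ContMDiff 𝓘(ℝ, E) 𝓘(ℝ, ℝ) ∞ V) {t : ℝ}
    {α β : ℝ → CotangentBundle E M} (hα : IsClassicalPath (hamiltonian V) t α)
    (hβ : IsClassicalPath (hamiltonian V) t β) (h0 : α 0 = β 0) : EqOn α β (Icc 0 t) := by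
  have : T2Space (CotangentBundle E M) := t2Space_cotangentBundle
  -- The set of agreement is closed, and it extends to the right of each of its points before `t` by
  -- uniqueness in one chart.
  refine IsClosed.Icc_subset_of_forall_mem_nhdsWithin (s := {s | α s = β s}) ?_ h0 ?_
  · rw [inter_comm]
    have := (hα.continuousOn hV).prodMk (hβ.continuousOn hV)
    exact this.preimage_isClosed_of_isClosed isClosed_Icc isClosed_diagonal
  · rintro s ⟨hs, hst⟩
    set y := (α s).proj with hy
    have hev : ∀ {γ : ℝ → CotangentBundle E M}, IsClassicalPath (hamiltonian V) t γ →
        γ s = α s → ∀ᶠ r in 𝓝[Icc 0 t] s, γ r ∈ (coChart E y).source := by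
      intro γ hγ hγs
      refine (hγ.continuousOn hV s (Ico_subset_Icc_self hst)).preimage_mem_nhdsWithin
        ((isOpen_coChart_source y).mem_nhds ?_)
      rw [hγs, coChart_source]
      exact mem_chart_source E y
    have hev2 := (hev hα rfl).and (hev hβ hs.symm)
    obtain ⟨δ, hδ, hδs⟩ := Metric.mem_nhdsWithin_iff.1 hev2
    set T := min (δ / 2) (t - s)
    have hT : 0 < T := lt_min (half_pos hδ) (sub_pos.2 hst.2)
    have hr : ∀ r ∈ Icc 0 T, s + r ∈ Metric.ball s δ ∩ Icc 0 t := by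
      intro r hr
      have h1 := hr.2.trans (min_le_left _ _)
      have h2 := hr.2.trans (min_le_right _ _)
      refine ⟨?_, by linarith [hr.1, hst.1], by linarith⟩
      rw [Metric.mem_ball, Real.dist_eq, add_sub_cancel_left, abs_of_nonneg hr.1]
      linarith
    have hsol : ∀ {γ : ℝ → CotangentBundle E M}, IsClassicalPath (hamiltonian V) t γ →
        (∀ r ∈ Icc 0 T, γ (s + r) ∈ (coChart E y).source) → ∀ r ∈ Icc 0 T,
        coChart E y (γ (s + r)) ∈ (coChart E y (M := M)).target ∧
        HasDerivWithinAt (fun r ↦ coChart E y (γ (s + r)))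
          (chartField V y (coChart E y (γ (s + r)))) (Icc 0 T) r := by
      intro γ hγ hγs r hr'
      have h1 := hγs r hr'
      refine ⟨(coChart E y).map_source h1, ?_⟩
      rw [coChart_source] at h1
      have h2 := (hγ.isChartSolutionAt hV (hr r hr').2 h1).2
      have h3 := HasDerivWithinAt.scomp r h2 (((hasDerivAt_id r).const_add s).hasDerivWithinAt)
        (fun r hr' ↦ (hr r hr').2)
      rwa [one_smul] at h3
    have heq := eqOn_of_hasDerivWithinAt (isOpen_coChart_target y)
      ((contDiffOn_chartField hV y).of_le (by simp))
      (hsol hα fun r hr' ↦ (hδs (hr r hr')).1) (hsol hβ fun r hr' ↦ (hδs (hr r hr')).2)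
      (by simp only [add_zero]; rw [show α s = β s from hs])
    filter_upwards [Ioo_mem_nhdsGT (show s < s + T by linarith)] with r hr'
    have hm : r - s ∈ Icc 0 T := ⟨by linarith [hr'.1], by linarith [hr'.2]⟩
    have h1 := hδs (hr _ hm)
    have h2 := heq hm
    simp only [add_sub_cancel] at h1 h2
    exact (coChart E y).injOn h1.1 h1.2 h2

end ClassicalPaths

/-! ### Classical paths obtained from the rescaled flow -/

section ChartPath

set_option synthInstance.maxHeartbeats 200000

variable {E : Type u} [NormedAddCommGroup E] [NormedSpace ℝ E]
  {M : Type*} [TopologicalSpace M] [ChartedSpace E M] [IsManifold 𝓘(ℝ, E) ∞ M]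
  [RiemannianBundle (fun x : M ↦ TangentSpace 𝓘(ℝ, E) x)]

/-- The rescaled Hamilton flow `Z` and its endpoint map `e` in the preferred chart at `y`. A point
`(ε, x, η)` is the initial condition `(x, η)` for the potential `ε V`. -/
structure ChartFlow (E : Type u) [NormedAddCommGroup E] [NormedSpace ℝ E]
    {M : Type*} [TopologicalSpace M] [ChartedSpace E M] [IsManifold 𝓘(ℝ, E) ∞ M]
    [RiemannianBundle (fun x : M ↦ TangentSpace 𝓘(ℝ, E) x)] (V : M → ℝ) (y : M) where
  /-- The endpoint map `(ε, x, η) ↦ (ε, x, x')`. -/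
  e : OpenPartialHomeomorph (ℝ × E × (E →L[ℝ] ℝ)) (ℝ × E × E)
  /-- The flow and its action as functions of the time and the initial condition. -/
  Z : ℝ × ℝ × E × (E →L[ℝ] ℝ) → (E × (E →L[ℝ] ℝ)) × ℝ
  mem_source : (0, extChartAt 𝓘(ℝ, E) y y, 0) ∈ e.source
  apply_center : e (0, extChartAt 𝓘(ℝ, E) y y, 0) =
    (0, extChartAt 𝓘(ℝ, E) y y, extChartAt 𝓘(ℝ, E) y y)
  contDiffOn_symm : ContDiffOn ℝ ∞ e.symm e.target
  contDiffOn_Z : ContDiffOn ℝ ∞ Z (Ioo (-1) 2 ×ˢ e.source)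
  apply_eq : ∀ p ∈ e.source, e p = (p.1, p.2.1, (Z (1, p)).1.1)
  Z_zero : ∀ p ∈ e.source, Z (0, p) = (p.2, 0)
  Z_mem : ∀ p ∈ e.source, ∀ k ∈ Ioo (-1 : ℝ) 2, (Z (k, p)).1.1 ∈ (extChartAt 𝓘(ℝ, E) y).target
  hasDerivAt_Z : ∀ p ∈ e.source, ∀ k ∈ Ioo (-1 : ℝ) 2, HasDerivAt (fun k ↦ (Z (k, p)).1)
    (hamiltonField (cometric E y) (coordPotential E V y) p.1 (Z (k, p)).1) k
  hasDerivAt_action : ∀ p ∈ e.source, ∀ k ∈ Ioo (-1 : ℝ) 2, HasDerivAt (fun k ↦ (Z (k, p)).2)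
    (phaseLagrangian (cometric E y) (coordPotential E V y) p.1 (Z (k, p)).1) k

/-- The path on `[0, t]` whose representation in the chart at `y` is the flow starting at `p`, run
at speed `1 / t`. -/
def ChartFlow.path {V : M → ℝ} {y : M} (F : ChartFlow E V y) (t : ℝ)
    (p : ℝ × E × (E →L[ℝ] ℝ)) (s : ℝ) : CotangentBundle E M :=
  (coChart E y).symm (scaleMomentum t⁻¹ (F.Z (t⁻¹ * s, p)).1)

theorem inv_mul_mem_Ioo {t s : ℝ} (ht : 0 < t) (hs : s ∈ Icc 0 t) : t⁻¹ * s ∈ Ioo (-1 : ℝ) 2 := by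
  have h1 : 0 ≤ t⁻¹ * s := mul_nonneg (inv_nonneg.2 ht.le) hs.1
  have h2 : t⁻¹ * s ≤ 1 := by
    rw [inv_mul_le_iff₀ ht, mul_one]
    exact hs.2
  exact ⟨by linarith, by linarith⟩

namespace ChartFlow

variable {V : M → ℝ} {y : M} (F : ChartFlow E V y) {t : ℝ} {w : E × (E →L[ℝ] ℝ)}

include F

theorem scaleMomentum_mem_target {p : ℝ × E × (E →L[ℝ] ℝ)} (hp : p ∈ F.e.source) (ht : 0 < t)
    {s : ℝ} (hs : s ∈ Icc 0 t) :
    scaleMomentum t⁻¹ (F.Z (t⁻¹ * s, p)).1 ∈ (coChart E y (M := M)).target := by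
  rw [coChart_target]
  exact ⟨F.Z_mem p hp _ (inv_mul_mem_Ioo ht hs), mem_univ _⟩

theorem coChart_path {p : ℝ × E × (E →L[ℝ] ℝ)} (hp : p ∈ F.e.source) (ht : 0 < t)
    {s : ℝ} (hs : s ∈ Icc 0 t) :
    coChart E y (F.path t p s) = scaleMomentum t⁻¹ (F.Z (t⁻¹ * s, p)).1 :=
  (coChart E y).right_inv (F.scaleMomentum_mem_target hp ht hs)

theorem path_proj_mem {p : ℝ × E × (E →L[ℝ] ℝ)} (hp : p ∈ F.e.source) (ht : 0 < t)
    {s : ℝ} (hs : s ∈ Icc 0 t) : (F.path t p s).proj ∈ (chartAt E y).source := by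
  have := (coChart E y (M := M)).map_target (F.scaleMomentum_mem_target hp ht hs)
  rwa [coChart_source] at this

theorem path_proj {p : ℝ × E × (E →L[ℝ] ℝ)} (hp : p ∈ F.e.source) (ht : 0 < t)
    {s : ℝ} (hs : s ∈ Icc 0 t) :
    (F.path t p s).proj = (extChartAt 𝓘(ℝ, E) y).symm (F.Z (t⁻¹ * s, p)).1.1 :=
  coChart_symm_proj (F.scaleMomentum_mem_target hp ht hs)

theorem path_zero {p : ℝ × E × (E →L[ℝ] ℝ)} (hp : p ∈ F.e.source) :
    F.path t p 0 = (coChart E y).symm (scaleMomentum t⁻¹ p.2) := by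
  rw [path, mul_zero, F.Z_zero p hp]

/-- With `ε = t ^ 2`, scaling by `t⁻¹` turns the potential `ε V` back into `V`. -/
theorem hasDerivAt_scaled_Z (hw : (t ^ 2, w) ∈ F.e.source) (ht : 0 < t) {s : ℝ}
    (hs : s ∈ Icc 0 t) :
    HasDerivAt (fun s ↦ scaleMomentum t⁻¹ (F.Z (t⁻¹ * s, t ^ 2, w)).1)
      (chartField V y (scaleMomentum t⁻¹ (F.Z (t⁻¹ * s, t ^ 2, w)).1)) s := by
  have h := hasDerivAt_scaleMomentum (F.hasDerivAt_Z _ hw _ (inv_mul_mem_Ioo ht hs))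
  have h1 : t⁻¹ ^ 2 * t ^ 2 = 1 := by field_simp
  rw [h1] at h
  exact h

variable [FiniteDimensional ℝ E]
  [IsContMDiffRiemannianBundle 𝓘(ℝ, E) ∞ E (fun x : M ↦ TangentSpace 𝓘(ℝ, E) x)]

theorem isClassicalPath_path (hV : ContMDiff 𝓘(ℝ, E) 𝓘(ℝ, ℝ) ∞ V)
    (hw : (t ^ 2, w) ∈ F.e.source) (ht : 0 < t) :
    IsClassicalPath (hamiltonian V) t (F.path t (t ^ 2, w)) := by
  refine isClassicalPath_of_isChartSolutionAt hV fun s hs ↦ ⟨F.path_proj_mem hw ht hs, ?_, ?_⟩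
  · have h1 : ContinuousAt (coChart E y (M := M)).symm
        (scaleMomentum t⁻¹ (F.Z (t⁻¹ * s, t ^ 2, w)).1) :=
      (continuousOn_extChartAt_symm _).continuousAt ((isOpen_coChart_target y).mem_nhds
        (F.scaleMomentum_mem_target hw ht hs))
    exact (ContinuousAt.comp (f := fun s ↦ scaleMomentum t⁻¹ (F.Z (t⁻¹ * s, t ^ 2, w)).1) h1
      (F.hasDerivAt_scaled_Z hw ht hs).continuousAt).continuousWithinAt
  · rw [F.coChart_path hw ht hs]
    exact (F.hasDerivAt_scaled_Z hw ht hs).hasDerivWithinAt.congr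
      (fun r hr ↦ F.coChart_path hw ht hr) (F.coChart_path hw ht hs)

theorem lagrangianAlong_path (hV : ContMDiff 𝓘(ℝ, E) 𝓘(ℝ, ℝ) ∞ V)
    (hw : (t ^ 2, w) ∈ F.e.source) (ht : 0 < t) {s : ℝ} (hs : s ∈ Icc 0 t) :
    lagrangianAlong V t (F.path t (t ^ 2, w)) s =
      phaseLagrangian (cometric E y) (coordPotential E V y) 1
        (scaleMomentum t⁻¹ (F.Z (t⁻¹ * s, t ^ 2, w)).1) := by
  have h1 := F.path_proj_mem hw ht hs
  rw [(F.isClassicalPath_path hV hw ht).lagrangianAlong_eq hV ht hs,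
    (norm_tangentSymm_cometric h1).1, F.coChart_path hw ht hs, F.path_proj hw ht hs,
    phaseLagrangian, one_mul]
  rfl

theorem continuousOn_lagrangianAlong_path (hV : ContMDiff 𝓘(ℝ, E) 𝓘(ℝ, ℝ) ∞ V)
    (hw : (t ^ 2, w) ∈ F.e.source) (ht : 0 < t) :
    ContinuousOn (lagrangianAlong V t (F.path t (t ^ 2, w))) (Icc 0 t) := by
  have h1 : ContinuousOn (fun s ↦ ((1 : ℝ), scaleMomentum t⁻¹ (F.Z (t⁻¹ * s, t ^ 2, w)).1))
      (Icc 0 t) := continuousOn_const.prodMk fun s hs ↦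
    (F.hasDerivAt_scaled_Z hw ht hs).continuousAt.continuousWithinAt
  have h2 := (contDiffOn_phaseLagrangian (contDiffOn_cometric y)
    (contDiffOn_coordPotential hV y)).continuousOn.comp h1
      fun s hs ↦ F.Z_mem _ hw _ (inv_mul_mem_Ioo ht hs)
  exact h2.congr fun s hs ↦ F.lagrangianAlong_path hV hw ht hs

theorem intervalIntegrable_lagrangianAlong_path (hV : ContMDiff 𝓘(ℝ, E) 𝓘(ℝ, ℝ) ∞ V)
    (hw : (t ^ 2, w) ∈ F.e.source) (ht : 0 < t) :
    IntervalIntegrable (lagrangianAlong V t (F.path t (t ^ 2, w))) volume 0 t :=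
  (by simpa [uIcc_of_le ht.le] using F.continuousOn_lagrangianAlong_path hV hw ht :
    ContinuousOn _ (uIcc 0 t)).intervalIntegrable

/-- The scaled action component `s ↦ t⁻¹ * a(t⁻¹ s)` is a primitive of the Lagrangian that vanishes
at `0`. This replaces the integral by a value of the smooth map `Z`. -/
theorem action_path (hV : ContMDiff 𝓘(ℝ, E) 𝓘(ℝ, ℝ) ∞ V)
    (hw : (t ^ 2, w) ∈ F.e.source) (ht : 0 < t) :
    action V t (F.path t (t ^ 2, w)) = t⁻¹ * (F.Z (1, t ^ 2, w)).2 := by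
  have h := intervalIntegral.integral_eq_sub_of_hasDerivAt
    (f := fun s ↦ t⁻¹ * (F.Z (t⁻¹ * s, t ^ 2, w)).2) (a := 0) (b := t) (fun s hs ↦ by
      rw [uIcc_of_le ht.le] at hs
      have h1 : t⁻¹ ^ 2 * t ^ 2 = 1 := by field_simp
      have h2 := hasDerivAt_scaleMomentum_action
        (z := fun k ↦ (F.Z (k, t ^ 2, w)).1) (F.hasDerivAt_action _ hw _ (inv_mul_mem_Ioo ht hs))
      rw [h1, ← F.lagrangianAlong_path hV hw ht hs] at h2
      exact h2) (F.intervalIntegrable_lagrangianAlong_path hV hw ht)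
  rw [action, h, inv_mul_cancel₀ ht.ne', mul_zero, F.Z_zero _ hw]
  simp

/-- A classical path that starts in the range of the flow is given by the flow. -/
theorem eqOn_path [T2Space M] (hV : ContMDiff 𝓘(ℝ, E) 𝓘(ℝ, ℝ) ∞ V) (ht : 0 < t)
    {c : ℝ → CotangentBundle E M} (hc : IsClassicalPath (hamiltonian V) t c)
    (hy : (c 0).proj ∈ (chartAt E y).source)
    (hw : (t ^ 2, scaleMomentum t (coChart E y (c 0))) ∈ F.e.source) :
    EqOn c (F.path t (t ^ 2, scaleMomentum t (coChart E y (c 0)))) (Icc 0 t) := by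
  refine hc.eqOn hV (F.isClassicalPath_path hV hw ht) ?_
  rw [F.path_zero hw]
  have h1 : scaleMomentum t⁻¹ (scaleMomentum t (coChart E y (c 0))) = coChart E y (c 0) := by
    simp [scaleMomentum, smul_smul, ht.ne']
  rw [h1, (coChart E y).left_inv (by rwa [coChart_source])]

/-- Two classical paths that start in the range of the flow and have the same endpoints agree. -/
theorem eqOn_of_mem_classicalPaths [T2Space M] (hV : ContMDiff 𝓘(ℝ, E) 𝓘(ℝ, ℝ) ∞ V) (ht : 0 < t)
    {a b : M} {c₁ c₂ : ℝ → CotangentBundle E M} (h₁ : c₁ ∈ classicalPaths (hamiltonian V) t a b)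
    (h₂ : c₂ ∈ classicalPaths (hamiltonian V) t a b) (hb : b ∈ (chartAt E y).source)
    (hw₁ : (t ^ 2, scaleMomentum t (coChart E y (c₁ 0))) ∈ F.e.source)
    (hw₂ : (t ^ 2, scaleMomentum t (coChart E y (c₂ 0))) ∈ F.e.source) :
    EqOn c₁ c₂ (Icc 0 t) := by
  have h0 : (0 : ℝ) ∈ Icc 0 t := left_mem_Icc.2 ht.le
  have h1 : t ∈ Icc 0 t := right_mem_Icc.2 ht.le
  -- The endpoint map sends the rescaled initial condition of either path to the same triple, so its
  -- injectivity gives equal initial conditions.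
  have key : ∀ {c : ℝ → CotangentBundle E M}, c ∈ classicalPaths (hamiltonian V) t a b →
      (t ^ 2, scaleMomentum t (coChart E y (c 0))) ∈ F.e.source →
      F.e (t ^ 2, scaleMomentum t (coChart E y (c 0))) =
        (t ^ 2, extChartAt 𝓘(ℝ, E) y b, extChartAt 𝓘(ℝ, E) y a) := by
    rintro c ⟨hc, hcb, hca⟩ hw
    have h2 := F.eqOn_path hV ht hc (by rwa [hcb]) hw h1
    have h3 := congrArg Prod.fst (F.coChart_path hw ht h1)
    rw [← h2, coChart_apply, hca, inv_mul_cancel₀ ht.ne'] at h3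
    rw [F.apply_eq _ hw]
    refine Prod.ext rfl (Prod.ext ?_ h3.symm)
    simp [scaleMomentum, coChart_apply, hcb]
  have h2 := F.e.injOn hw₁ hw₂ ((key h₁ hw₁).trans (key h₂ hw₂).symm)
  intro s hs
  rw [F.eqOn_path hV ht h₁.1 (by rwa [h₁.2.1]) hw₁ hs,
    F.eqOn_path hV ht h₂.1 (by rwa [h₂.2.1]) hw₂ hs, h2]

end ChartFlow

theorem nonempty_chartFlow [FiniteDimensional ℝ E]
    [IsContMDiffRiemannianBundle 𝓘(ℝ, E) ∞ E (fun x : M ↦ TangentSpace 𝓘(ℝ, E) x)] {V : M → ℝ}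
    (hV : ContMDiff 𝓘(ℝ, E) 𝓘(ℝ, ℝ) ∞ V) (y : M) :
    Nonempty (ChartFlow E V y) := by
  obtain ⟨e, Z, h1, h2, h3, h4, h5⟩ := exists_hamiltonFlow_endpoint (isOpen_extChartAt_target y)
    (contDiffOn_cometric y) (contDiffOn_coordPotential hV y) (mem_extChartAt_target y)
    (cometric_injective (mem_extChartAt_target y))
  exact ⟨e, Z, h1, h2, h3, h4, fun p hp ↦ (h5 p hp).1, fun p hp ↦ (h5 p hp).2.1,
    fun p hp k hk ↦ ((h5 p hp).2.2 k hk).1, fun p hp k hk ↦ ((h5 p hp).2.2 k hk).2.1,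
    fun p hp k hk ↦ ((h5 p hp).2.2 k hk).2.2⟩

end ChartPath

/-! ### Existence, uniqueness and smoothness near one point -/

section LocalTheory

set_option synthInstance.maxHeartbeats 200000

variable {E : Type u} [NormedAddCommGroup E] [NormedSpace ℝ E]
  {M : Type*} [TopologicalSpace M] [ChartedSpace E M] [IsManifold 𝓘(ℝ, E) ∞ M]
  [RiemannianBundle (fun x : M ↦ TangentSpace 𝓘(ℝ, E) x)]
  [FiniteDimensional ℝ E]
  [IsContMDiffRiemannianBundle 𝓘(ℝ, E) ∞ E (fun x : M ↦ TangentSpace 𝓘(ℝ, E) x)]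
  {V : M → ℝ} {y : M}

omit [FiniteDimensional ℝ E] in
/-- Momenta are locally bounded in coordinates by their Riemannian norms. -/
theorem exists_norm_coChart_le (y : M) : ∃ C > 0, ∀ᶠ x in 𝓝 y, ∀ p : CotangentBundle E M,
    p.proj = x → ‖(coChart E y p).2‖ ≤ C * momentumNorm p := by
  have : IsContinuousRiemannianBundle E (fun x : M ↦ TangentSpace 𝓘(ℝ, E) x) :=
    have ⟨g, hg, hg'⟩ := IsContMDiffRiemannianBundle.exists_contMDiff (IB := 𝓘(ℝ, E)) (n := ∞)
      (F := E) (E := fun x : M ↦ TangentSpace 𝓘(ℝ, E) x)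
    ⟨g, hg.continuous, hg'⟩
  obtain ⟨C, hC, h⟩ := eventually_norm_symmL_trivializationAt_lt E
    (fun x : M ↦ TangentSpace 𝓘(ℝ, E) x) y
  refine ⟨C, hC, h.mono ?_⟩
  rintro _ hx p rfl
  rw [coChart_apply]
  refine (ContinuousLinearMap.opNorm_comp_le p.2 (tangentSymm y p.proj)).trans ?_
  rw [mul_comm]
  exact mul_le_mul_of_nonneg_right hx.le (norm_nonneg _)

namespace ChartFlow

/-- The bound `r / t` on `|ξ|` is the bound `r` on `|tξ|`, so rescaled initial conditions lie in the
domain of the endpoint map. Only the starting point must be near `y`; the endpoint `a` is arbitrary.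
-/
theorem exists_eqOn_of_mem_lowClassicalPaths [T2Space M] (hV : ContMDiff 𝓘(ℝ, E) 𝓘(ℝ, ℝ) ∞ V)
    (F : ChartFlow E V y) :
    ∃ r > 0, ∀ᶠ b in 𝓝 y, ∀ t ∈ Ioo 0 r, ∀ a : M,
      ∀ c₁ ∈ lowClassicalPaths (E := E) (hamiltonian V) t a b (r / t),
      ∀ c₂ ∈ lowClassicalPaths (E := E) (hamiltonian V) t a b (r / t), EqOn c₁ c₂ (Icc 0 t) := by
  obtain ⟨δ, hδ, hδs⟩ := Metric.isOpen_iff.1 F.e.open_source _ F.mem_source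
  obtain ⟨C, hC, hev⟩ := exists_norm_coChart_le (E := E) y
  -- The bounds `1` and `δ` on `t` give `t ^ 2 < δ`; the bound `δ / C` makes the coordinate norm of
  -- the rescaled momentum less than `δ`.
  refine ⟨min (min 1 δ) (δ / C), by positivity, ?_⟩
  filter_upwards [hev, (continuousAt_extChartAt (I := 𝓘(ℝ, E)) y).eventually
    (Metric.ball_mem_nhds _ hδ), (chartAt E y).open_source.mem_nhds (mem_chart_source E y)]
    with b hb hb' hbs t ht a c₁ h₁ c₂ h₂
  have key : ∀ {c : ℝ → CotangentBundle E M},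
      c ∈ lowClassicalPaths (hamiltonian V) t a b (min (min 1 δ) (δ / C) / t) →
      (t ^ 2, scaleMomentum t (coChart E y (c 0))) ∈ F.e.source := by
    rintro c ⟨⟨_, hc, _⟩, hn⟩
    have ht1 : t < 1 := ht.2.trans_le ((min_le_left _ _).trans (min_le_left _ _))
    have htδ : t < δ := ht.2.trans_le ((min_le_left _ _).trans (min_le_right _ _))
    refine hδs ?_
    rw [Metric.mem_ball, Prod.dist_eq, Prod.dist_eq, max_lt_iff, max_lt_iff]
    refine ⟨?_, ?_, ?_⟩
    · rw [Real.dist_eq, sub_zero, abs_of_nonneg (sq_nonneg t)]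
      nlinarith [ht.1]
    · simp only [scaleMomentum, coChart_apply, hc]
      exact hb'
    · simp only [scaleMomentum, dist_zero_right]
      have h3 := hb (c 0) hc
      have h4 : momentumNorm (c 0) * t < δ / C :=
        ((lt_div_iff₀ ht.1).1 hn).trans_le (min_le_right _ _)
      rw [lt_div_iff₀ hC] at h4
      rw [norm_smul, Real.norm_of_nonneg ht.1.le]
      nlinarith [mul_le_mul_of_nonneg_left h3 ht.1.le]
  exact F.eqOn_of_mem_classicalPaths hV ht.1 h₁.1 h₂.1 hbs (key h₁) (key h₂)

/-- The path from `b` to `a` in time `t` given by the flow. -/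
def connectingPath (F : ChartFlow E V y) (t : ℝ) (a b : M) : ℝ → CotangentBundle E M :=
  F.path t (F.e.symm (t ^ 2, extChartAt 𝓘(ℝ, E) y b, extChartAt 𝓘(ℝ, E) y a))

/-- The parameters for which the connecting path exists. -/
def parameterSet (F : ChartFlow E V y) : Set (ℝ × M × M) :=
  {p | 0 < p.1 ∧ p.2.1 ∈ (chartAt E y).source ∧ p.2.2 ∈ (chartAt E y).source ∧
    (p.1 ^ 2, extChartAt 𝓘(ℝ, E) y p.2.2, extChartAt 𝓘(ℝ, E) y p.2.1) ∈ F.e.target}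

variable (F : ChartFlow E V y) {t : ℝ} {a b : M}

omit [FiniteDimensional ℝ E]
  [IsContMDiffRiemannianBundle 𝓘(ℝ, E) ∞ E (fun x : M ↦ TangentSpace 𝓘(ℝ, E) x)] in
-- The endpoint map preserves `ε` and the starting point, hence so does its inverse.
theorem exists_symm_eq (h : (t, a, b) ∈ F.parameterSet) : ∃ η : E →L[ℝ] ℝ,
    F.e.symm (t ^ 2, extChartAt 𝓘(ℝ, E) y b, extChartAt 𝓘(ℝ, E) y a) =
      (t ^ 2, extChartAt 𝓘(ℝ, E) y b, η) ∧
    (t ^ 2, extChartAt 𝓘(ℝ, E) y b, η) ∈ F.e.source ∧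
    (F.Z (1, t ^ 2, extChartAt 𝓘(ℝ, E) y b, η)).1.1 = extChartAt 𝓘(ℝ, E) y a := by
  obtain ⟨-, -, -, hq⟩ := h
  have h1 := F.e.map_target hq
  have h2 := F.e.right_inv hq
  rw [F.apply_eq _ h1] at h2
  have h3 : F.e.symm (t ^ 2, extChartAt 𝓘(ℝ, E) y b, extChartAt 𝓘(ℝ, E) y a) =
      (t ^ 2, extChartAt 𝓘(ℝ, E) y b,
        (F.e.symm (t ^ 2, extChartAt 𝓘(ℝ, E) y b, extChartAt 𝓘(ℝ, E) y a)).2.2) :=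
    Prod.ext (congrArg (fun q : ℝ × E × E ↦ q.1) h2)
      (Prod.ext (congrArg (fun q : ℝ × E × E ↦ q.2.1) h2) rfl)
  refine ⟨_, h3, by rwa [h3] at h1, ?_⟩
  rw [← h3]
  exact congrArg (fun q : ℝ × E × E ↦ q.2.2) h2

theorem connectingPath_mem_classicalPaths (hV : ContMDiff 𝓘(ℝ, E) 𝓘(ℝ, ℝ) ∞ V)
    (h : (t, a, b) ∈ F.parameterSet) :
    F.connectingPath t a b ∈ classicalPaths (hamiltonian V) t a b := by
  obtain ⟨η, h1, h2, h3⟩ := F.exists_symm_eq h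
  obtain ⟨ht, ha, hb, -⟩ := h
  rw [connectingPath, h1]
  refine ⟨F.isClassicalPath_path hV h2 ht, ?_, ?_⟩
  · rw [F.path_proj h2 ht (left_mem_Icc.2 ht.le), mul_zero, F.Z_zero _ h2]
    exact (extChartAt 𝓘(ℝ, E) y).left_inv (by simpa using hb)
  · rw [F.path_proj h2 ht (right_mem_Icc.2 ht.le), inv_mul_cancel₀ ht.ne', h3]
    exact (extChartAt 𝓘(ℝ, E) y).left_inv (by simpa using ha)

omit [IsContMDiffRiemannianBundle 𝓘(ℝ, E) ∞ E (fun x : M ↦ TangentSpace 𝓘(ℝ, E) x)] in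
-- The right-hand side involves only the inverse endpoint map and the dual metric, so it remains
-- continuous at `t = 0`, where the momentum itself need not be bounded.
theorem momentumNorm_connectingPath (h : (t, a, b) ∈ F.parameterSet) :
    (t * momentumNorm (F.connectingPath t a b 0)) ^ 2 =
      (F.e.symm (t ^ 2, extChartAt 𝓘(ℝ, E) y b, extChartAt 𝓘(ℝ, E) y a)).2.2
        (cometric E y
          (F.e.symm (t ^ 2, extChartAt 𝓘(ℝ, E) y b, extChartAt 𝓘(ℝ, E) y a)).2.1
          (F.e.symm (t ^ 2, extChartAt 𝓘(ℝ, E) y b, extChartAt 𝓘(ℝ, E) y a)).2.2) := by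
  obtain ⟨η, h1, h2, h3⟩ := F.exists_symm_eq h
  have ht : 0 < t := h.1
  have h0 : (0 : ℝ) ∈ Icc 0 t := left_mem_Icc.2 ht.le
  rw [connectingPath, h1, mul_pow, (norm_tangentSymm_cometric (F.path_proj_mem h2 ht h0)).1,
    F.coChart_path h2 ht h0, mul_zero, F.Z_zero _ h2]
  simp [scaleMomentum]
  field_simp

/-- The rescaled squared momentum `G` is continuous and vanishes at `(0, x₀, x₀)`, because the
stationary point has that endpoint triple. It is therefore below `r ^ 2` nearby. -/
theorem exists_connectingPath_mem_lowClassicalPaths (hV : ContMDiff 𝓘(ℝ, E) 𝓘(ℝ, ℝ) ∞ V) {r : ℝ}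
    (hr : 0 < r) : ∃ t₀ > 0, ∃ U : Set M, IsOpen U ∧ y ∈ U ∧ ∀ t ∈ Ioo 0 t₀, ∀ a ∈ U, ∀ b ∈ U,
      (t, a, b) ∈ F.parameterSet ∧
        F.connectingPath t a b ∈ lowClassicalPaths (hamiltonian V) t a b (r / t) := by
  set x₀ := extChartAt 𝓘(ℝ, E) y y with hx₀
  let Q : ℝ × M × M → ℝ × E × E := fun p ↦
    (p.1 ^ 2, extChartAt 𝓘(ℝ, E) y p.2.2, extChartAt 𝓘(ℝ, E) y p.2.1)
  let G : ℝ × E × E → ℝ := fun q ↦ (F.e.symm q).2.2 (cometric E y (F.e.symm q).2.1 (F.e.symm q).2.2)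
  have hQ0 : Q (0, y, y) = (0, x₀, x₀) := by simp [Q, x₀]
  have hQ : ContinuousAt Q (0, y, y) := by
    have h1 := continuousAt_extChartAt (I := 𝓘(ℝ, E)) y
    refine (continuousAt_fst.pow 2).prodMk (ContinuousAt.prodMk ?_ ?_)
    · exact ContinuousAt.comp (f := fun p : ℝ × M × M ↦ p.2.2) h1 (by fun_prop)
    · exact ContinuousAt.comp (f := fun p : ℝ × M × M ↦ p.2.1) h1 (by fun_prop)
  have htgt : (0, x₀, x₀) ∈ F.e.target := by
    rw [hx₀, ← F.apply_center]
    exact F.e.map_source F.mem_source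
  have hsymm : F.e.symm (0, x₀, x₀) = (0, x₀, 0) := by
    rw [hx₀, ← F.apply_center, F.e.left_inv F.mem_source]
  have hG0 : G (0, x₀, x₀) = 0 := by simp [G, hsymm]
  have hG : ContinuousAt G (0, x₀, x₀) := by
    have h1 : ContinuousAt F.e.symm (0, x₀, x₀) := F.e.continuousAt_symm htgt
    have h2 : ContinuousAt (cometric E y) (F.e.symm (0, x₀, x₀)).2.1 := by
      rw [hsymm]
      exact (differentiableAt_cometric (mem_chart_source E y)).continuousAt
    have h3 : ContinuousAt (fun q ↦ cometric E y (F.e.symm q).2.1) (0, x₀, x₀) :=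
      ContinuousAt.comp (f := fun q ↦ (F.e.symm q).2.1) h2 h1.snd.fst
    exact h1.snd.snd.clm_apply (h3.clm_apply h1.snd.snd)
  have hev : ∀ᶠ p in 𝓝 ((0 : ℝ), y, y), Q p ∈ F.e.target ∧ G (Q p) < r ^ 2 ∧
      p.2.1 ∈ (chartAt E y).source ∧ p.2.2 ∈ (chartAt E y).source := by
    have hs := (chartAt E y).open_source.mem_nhds (mem_chart_source E y)
    refine (hQ.eventually (by rw [hQ0]; exact F.e.open_target.mem_nhds htgt)).and
      (.and ?_ (.and ?_ ?_))
    · refine (ContinuousAt.comp (by rwa [hQ0]) hQ).eventually_lt continuousAt_const ?_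
      simp only [Function.comp, hQ0, hG0]
      positivity
    · exact (continuous_fst.comp continuous_snd).continuousAt.eventually hs
    · exact (continuous_snd.comp continuous_snd).continuousAt.eventually hs
  obtain ⟨I, hI, W, hW, hIW⟩ := mem_nhds_prod_iff.1 hev
  obtain ⟨U₁, hU₁, U₂, hU₂, hUU⟩ := mem_nhds_prod_iff.1 hW
  obtain ⟨t₀, ht₀, htI⟩ := Metric.mem_nhds_iff.1 hI
  refine ⟨t₀, ht₀, interior (U₁ ∩ U₂), isOpen_interior, mem_interior_iff_mem_nhds.2
    (Filter.inter_mem hU₁ hU₂), fun t ht a ha b hb ↦ ?_⟩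
  obtain ⟨h1, h2, h3, h4⟩ := hIW (mk_mem_prod (htI (by
    rw [Metric.mem_ball, Real.dist_eq, sub_zero, abs_of_pos ht.1]
    exact ht.2)) (hUU (mk_mem_prod (interior_subset ha).1 (interior_subset hb).2)))
  have hp : (t, a, b) ∈ F.parameterSet := ⟨ht.1, h3, h4, h1⟩
  refine ⟨hp, F.connectingPath_mem_classicalPaths hV hp, ?_⟩
  have h5 := F.momentumNorm_connectingPath hp
  rw [lt_div_iff₀ ht.1, mul_comm]
  refine lt_of_pow_lt_pow_left₀ 2 hr.le ?_
  rw [h5]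
  exact h2

theorem intervalIntegrable_connectingPath (hV : ContMDiff 𝓘(ℝ, E) 𝓘(ℝ, ℝ) ∞ V)
    (h : (t, a, b) ∈ F.parameterSet) :
    IntervalIntegrable (lagrangianAlong V t (F.connectingPath t a b)) volume 0 t := by
  obtain ⟨η, h1, h2, -⟩ := F.exists_symm_eq h
  rw [connectingPath, h1]
  exact F.intervalIntegrable_lagrangianAlong_path hV h2 h.1

theorem action_connectingPath (hV : ContMDiff 𝓘(ℝ, E) 𝓘(ℝ, ℝ) ∞ V)
    (h : (t, a, b) ∈ F.parameterSet) :
    action V t (F.connectingPath t a b) = t⁻¹ *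
      (F.Z (1, F.e.symm (t ^ 2, extChartAt 𝓘(ℝ, E) y b, extChartAt 𝓘(ℝ, E) y a))).2 := by
  obtain ⟨η, h1, h2, -⟩ := F.exists_symm_eq h
  rw [connectingPath, h1, F.action_path hV h2 h.1]

omit [FiniteDimensional ℝ E]
  [IsContMDiffRiemannianBundle 𝓘(ℝ, E) ∞ E (fun x : M ↦ TangentSpace 𝓘(ℝ, E) x)] in
theorem contMDiffOn_symm_parameters :
    ContMDiffOn (𝓘(ℝ, ℝ).prod (𝓘(ℝ, E).prod 𝓘(ℝ, E))) 𝓘(ℝ, ℝ × E × (E →L[ℝ] ℝ)) ∞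
      (fun p : ℝ × M × M ↦
        F.e.symm (p.1 ^ 2, extChartAt 𝓘(ℝ, E) y p.2.2, extChartAt 𝓘(ℝ, E) y p.2.1))
      F.parameterSet := by
  have h1 : ContMDiffOn (𝓘(ℝ, ℝ).prod (𝓘(ℝ, E).prod 𝓘(ℝ, E))) 𝓘(ℝ, ℝ) ∞
      (fun p : ℝ × M × M ↦ p.1 ^ 2) F.parameterSet :=
    (contDiff_id.pow 2).contMDiff.comp_contMDiffOn contMDiffOn_fst
  have h2 : ContMDiffOn (𝓘(ℝ, ℝ).prod (𝓘(ℝ, E).prod 𝓘(ℝ, E))) 𝓘(ℝ, E) ∞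
      (fun p : ℝ × M × M ↦ extChartAt 𝓘(ℝ, E) y p.2.2) F.parameterSet :=
    (contMDiffOn_extChartAt (x := y)).comp (contMDiff_snd.snd.contMDiffOn) fun p hp ↦ hp.2.2.1
  have h3 : ContMDiffOn (𝓘(ℝ, ℝ).prod (𝓘(ℝ, E).prod 𝓘(ℝ, E))) 𝓘(ℝ, E) ∞
      (fun p : ℝ × M × M ↦ extChartAt 𝓘(ℝ, E) y p.2.1) F.parameterSet :=
    (contMDiffOn_extChartAt (x := y)).comp (contMDiff_snd.fst.contMDiffOn) fun p hp ↦ hp.2.1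
  exact F.contDiffOn_symm.contMDiffOn.comp (h1.prodMk_space (h2.prodMk_space h3))
    fun p hp ↦ hp.2.2.2

omit [FiniteDimensional ℝ E]
  [IsContMDiffRiemannianBundle 𝓘(ℝ, E) ∞ E (fun x : M ↦ TangentSpace 𝓘(ℝ, E) x)] in
-- Smoothness holds up to `s = 0` and `s = t`, since `t⁻¹ * s ∈ [0, 1]` lies inside the open
-- interval `(-1, 2)` on which `Z` is smooth.
theorem contMDiffOn_connectingPath :
    ContMDiffOn (𝓘(ℝ, ℝ).prod (𝓘(ℝ, E).prod (𝓘(ℝ, E).prod 𝓘(ℝ, ℝ)))) (cotangentModel E) ∞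
      (fun p : ℝ × M × M × ℝ ↦ F.connectingPath p.1 p.2.1 p.2.2.1 p.2.2.2)
      {p | (p.1, p.2.1, p.2.2.1) ∈ F.parameterSet ∧ p.2.2.2 ∈ Icc 0 p.1} := by
  set D : Set (ℝ × M × M × ℝ) :=
    {p | (p.1, p.2.1, p.2.2.1) ∈ F.parameterSet ∧ p.2.2.2 ∈ Icc 0 p.1}
  set J := 𝓘(ℝ, ℝ).prod (𝓘(ℝ, E).prod (𝓘(ℝ, E).prod 𝓘(ℝ, ℝ)))
  have hp : ContMDiffOn J 𝓘(ℝ, ℝ × E × (E →L[ℝ] ℝ)) ∞ (fun p : ℝ × M × M × ℝ ↦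
      F.e.symm (p.1 ^ 2, extChartAt 𝓘(ℝ, E) y p.2.2.1, extChartAt 𝓘(ℝ, E) y p.2.1)) D :=
    F.contMDiffOn_symm_parameters.comp (f := fun p : ℝ × M × M × ℝ ↦ (p.1, p.2.1, p.2.2.1))
      (contMDiff_fst.prodMk (contMDiff_snd.fst.prodMk contMDiff_snd.snd.fst)).contMDiffOn
      fun p hp ↦ hp.1
  have hinv : ContMDiffOn J 𝓘(ℝ, ℝ) ∞ (fun p : ℝ × M × M × ℝ ↦ p.1⁻¹) D := by
    have h1 : ContDiffOn ℝ ∞ (fun t : ℝ ↦ t⁻¹) (Ioi 0) :=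
      contDiffOn_id.inv fun t ht ↦ (ne_of_gt ht)
    exact h1.contMDiffOn.comp contMDiffOn_fst fun p hp ↦ hp.1.1
  have hk : ContMDiffOn J 𝓘(ℝ, ℝ) ∞ (fun p : ℝ × M × M × ℝ ↦ p.1⁻¹ * p.2.2.2) D :=
    hinv.smul contMDiff_snd.snd.snd.contMDiffOn
  have hZ := F.contDiffOn_Z.contMDiffOn.comp (hk.prodMk_space hp) fun p hp ↦
    ⟨inv_mul_mem_Ioo hp.1.1 hp.2, F.e.map_target hp.1.2.2.2⟩
  have hz : ContMDiffOn J 𝓘(ℝ, E × (E →L[ℝ] ℝ)) ∞ (fun p : ℝ × M × M × ℝ ↦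
      scaleMomentum p.1⁻¹ (F.Z (p.1⁻¹ * p.2.2.2,
        F.e.symm (p.1 ^ 2, extChartAt 𝓘(ℝ, E) y p.2.2.1, extChartAt 𝓘(ℝ, E) y p.2.1))).1) D := by
    have h1 := (contDiff_fst.fst (𝕜 := ℝ) (n := ∞)).contMDiff.comp_contMDiffOn hZ
    have h2 := (contDiff_fst.snd (𝕜 := ℝ) (n := ∞)).contMDiff.comp_contMDiffOn hZ
    exact h1.prodMk_space (hinv.smul h2)
  have hc : ContMDiffOn 𝓘(ℝ, E × (E →L[ℝ] ℝ)) (cotangentModel E) ∞ (coChart E y (M := M)).symm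
      (coChart E y (M := M)).target := contMDiffOn_extChartAt_symm _
  exact hc.comp hz fun p hp ↦
    F.scaleMomentum_mem_target (F.e.map_target hp.1.2.2.2) hp.1.1 hp.2

theorem contMDiffOn_action_connectingPath (hV : ContMDiff 𝓘(ℝ, E) 𝓘(ℝ, ℝ) ∞ V) :
    ContMDiffOn (𝓘(ℝ, ℝ).prod (𝓘(ℝ, E).prod 𝓘(ℝ, E))) 𝓘(ℝ, ℝ) ∞
      (fun p : ℝ × M × M ↦ action V p.1 (F.connectingPath p.1 p.2.1 p.2.2)) F.parameterSet := by
  have hinv : ContMDiffOn (𝓘(ℝ, ℝ).prod (𝓘(ℝ, E).prod 𝓘(ℝ, E))) 𝓘(ℝ, ℝ) ∞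
      (fun p : ℝ × M × M ↦ p.1⁻¹) F.parameterSet := by
    have h1 : ContDiffOn ℝ ∞ (fun t : ℝ ↦ t⁻¹) (Ioi 0) :=
      contDiffOn_id.inv fun t ht ↦ (ne_of_gt ht)
    exact h1.contMDiffOn.comp contMDiffOn_fst fun p hp ↦ hp.1
  have hZ := F.contDiffOn_Z.contMDiffOn.comp
    ((contMDiffOn_const (c := (1 : ℝ))).prodMk_space F.contMDiffOn_symm_parameters) fun p hp ↦
    ⟨by norm_num, F.e.map_target hp.2.2.2⟩
  have h2 := (contDiff_snd (𝕜 := ℝ) (n := ∞)).contMDiff.comp_contMDiffOn hZ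
  exact (hinv.smul h2).congr fun p hp ↦ F.action_connectingPath hV hp

end ChartFlow

end LocalTheory

/-! ### Uniform constants by compactness -/

section Globalization

set_option synthInstance.maxHeartbeats 200000

variable {E : Type u} [NormedAddCommGroup E] [NormedSpace ℝ E]
  {M : Type*} [TopologicalSpace M] [ChartedSpace E M] [IsManifold 𝓘(ℝ, E) ∞ M]
  [RiemannianBundle (fun x : M ↦ TangentSpace 𝓘(ℝ, E) x)]
  [FiniteDimensional ℝ E]
  [IsContMDiffRiemannianBundle 𝓘(ℝ, E) ∞ E (fun x : M ↦ TangentSpace 𝓘(ℝ, E) x)]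
  {V : M → ℝ}

omit [FiniteDimensional ℝ E]
  [IsContMDiffRiemannianBundle 𝓘(ℝ, E) ∞ E (fun x : M ↦ TangentSpace 𝓘(ℝ, E) x)] in
theorem lowClassicalPaths_mono {H : CotangentBundle E M → ℝ} {t : ℝ} {a b : M} {r r' : ℝ}
    (h : r ≤ r') : lowClassicalPaths H t a b r ⊆ lowClassicalPaths H t a b r' :=
  fun _ hc ↦ ⟨hc.1, hc.2.trans_le h⟩

/-- By the Legendre transform the Lagrangian along a classical path depends only on the value of the
path at `s`, so agreement on `[0, t]` suffices. -/
theorem action_congr (hV : ContMDiff 𝓘(ℝ, E) 𝓘(ℝ, ℝ) ∞ V) {t : ℝ} (ht : 0 < t)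
    {α β : ℝ → CotangentBundle E M} (hα : IsClassicalPath (hamiltonian V) t α)
    (hβ : IsClassicalPath (hamiltonian V) t β) (h : EqOn α β (Icc 0 t)) :
    action V t α = action V t β := by
  refine intervalIntegral.integral_congr fun s hs ↦ ?_
  rw [uIcc_of_le ht.le] at hs
  rw [hα.lagrangianAlong_eq hV ht hs, hβ.lagrangianAlong_eq hV ht hs, h hs]

omit [IsManifold 𝓘(ℝ, E) ∞ M] [FiniteDimensional ℝ E]
  [IsContMDiffRiemannianBundle 𝓘(ℝ, E) ∞ E (fun x : M ↦ TangentSpace 𝓘(ℝ, E) x)] in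
theorem hamiltonian_lt_hamiltonian {p q : CotangentBundle E M} (h : p.proj = q.proj)
    (hpq : momentumNorm p < momentumNorm q) : hamiltonian V p < hamiltonian V q := by
  have h0 : 0 ≤ momentumNorm p := norm_nonneg p.2
  rw [hamiltonian, hamiltonian, h]
  nlinarith

/-- Low-energy paths with given endpoints are unique, uniformly on compact manifolds. -/
theorem exists_eqOn_of_mem_lowClassicalPaths [T2Space M] [CompactSpace M]
    (hV : ContMDiff 𝓘(ℝ, E) 𝓘(ℝ, ℝ) ∞ V) :
    ∃ r > 0, ∀ b : M, ∀ t ∈ Ioo 0 r, ∀ a : M,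
      ∀ c₁ ∈ lowClassicalPaths (E := E) (hamiltonian V) t a b (r / t),
      ∀ c₂ ∈ lowClassicalPaths (E := E) (hamiltonian V) t a b (r / t), EqOn c₁ c₂ (Icc 0 t) := by
  suffices h : ∃ r > 0, ∀ b ∈ (univ : Set M), ∀ t ∈ Ioo 0 r, ∀ a : M,
      ∀ c₁ ∈ lowClassicalPaths (E := E) (hamiltonian V) t a b (r / t),
      ∀ c₂ ∈ lowClassicalPaths (E := E) (hamiltonian V) t a b (r / t), EqOn c₁ c₂ (Icc 0 t) by
    simpa using h
  have hmono : ∀ {r r' : ℝ} {b : M}, r ≤ r' →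
      (∀ t ∈ Ioo 0 r', ∀ a : M,
        ∀ c₁ ∈ lowClassicalPaths (E := E) (hamiltonian V) t a b (r' / t),
        ∀ c₂ ∈ lowClassicalPaths (E := E) (hamiltonian V) t a b (r' / t), EqOn c₁ c₂ (Icc 0 t)) →
      ∀ t ∈ Ioo 0 r, ∀ a : M,
        ∀ c₁ ∈ lowClassicalPaths (E := E) (hamiltonian V) t a b (r / t),
        ∀ c₂ ∈ lowClassicalPaths (E := E) (hamiltonian V) t a b (r / t), EqOn c₁ c₂ (Icc 0 t) :=
    fun hr h t ht a c₁ h₁ c₂ h₂ ↦ h t ⟨ht.1, ht.2.trans_le hr⟩ a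
      c₁ (lowClassicalPaths_mono (div_le_div_of_nonneg_right hr ht.1.le) h₁)
      c₂ (lowClassicalPaths_mono (div_le_div_of_nonneg_right hr ht.1.le) h₂)
  -- Compactness as induction on sets of starting points: the property holds near each point and
  -- passes to unions with the smaller radius, by `hmono`.
  refine isCompact_univ.induction_on ⟨1, one_pos, by simp⟩ ?_ ?_ ?_
  · rintro S T hST ⟨r, hr, h⟩
    exact ⟨r, hr, fun b hb ↦ h b (hST hb)⟩
  · rintro S T ⟨r, hr, h⟩ ⟨r', hr', h'⟩
    refine ⟨min r r', lt_min hr hr', fun b hb ↦ ?_⟩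
    rcases hb with hb | hb
    · exact hmono (min_le_left _ _) (h b hb)
    · exact hmono (min_le_right _ _) (h' b hb)
  · intro y _
    obtain ⟨F⟩ := nonempty_chartFlow hV y
    obtain ⟨r, hr, h⟩ := F.exists_eqOn_of_mem_lowClassicalPaths hV
    exact ⟨_, mem_nhdsWithin_of_mem_nhds h, r, hr, fun b hb ↦ hb⟩

/-- Near every point of the diagonal, endpoints are connected by the flow in one chart for a uniform
time. -/
theorem exists_connectingPath_mem_lowClassicalPaths [CompactSpace M]
    (hV : ContMDiff 𝓘(ℝ, E) 𝓘(ℝ, ℝ) ∞ V) {r : ℝ} (hr : 0 < r) :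
    ∃ t₀ > 0, ∀ z : M, ∃ (y : M) (F : ChartFlow E V y) (U : Set M), IsOpen U ∧ z ∈ U ∧
      ∀ t ∈ Ioo 0 t₀, ∀ a ∈ U, ∀ b ∈ U, (t, a, b) ∈ F.parameterSet ∧
        F.connectingPath t a b ∈ lowClassicalPaths (hamiltonian V) t a b (r / t) := by
  suffices h : ∃ t₀ > 0, ∀ z ∈ (univ : Set M), ∃ (y : M) (F : ChartFlow E V y) (U : Set M),
      IsOpen U ∧ z ∈ U ∧ ∀ t ∈ Ioo 0 t₀, ∀ a ∈ U, ∀ b ∈ U, (t, a, b) ∈ F.parameterSet ∧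
        F.connectingPath t a b ∈ lowClassicalPaths (hamiltonian V) t a b (r / t) by
    simpa using h
  refine isCompact_univ.induction_on ⟨1, one_pos, by simp⟩ ?_ ?_ ?_
  · rintro S T hST ⟨t₀, ht₀, h⟩
    exact ⟨t₀, ht₀, fun z hz ↦ h z (hST hz)⟩
  · rintro S T ⟨t₁, ht₁, h₁⟩ ⟨t₂, ht₂, h₂⟩
    refine ⟨min t₁ t₂, lt_min ht₁ ht₂, fun z hz ↦ ?_⟩
    rcases hz with hz | hz
    · obtain ⟨y, F, U, hU, hzU, h⟩ := h₁ z hz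
      exact ⟨y, F, U, hU, hzU, fun t ht ↦ h t ⟨ht.1, ht.2.trans_le (min_le_left _ _)⟩⟩
    · obtain ⟨y, F, U, hU, hzU, h⟩ := h₂ z hz
      exact ⟨y, F, U, hU, hzU, fun t ht ↦ h t ⟨ht.1, ht.2.trans_le (min_le_right _ _)⟩⟩
  · intro y _
    obtain ⟨F⟩ := nonempty_chartFlow hV y
    obtain ⟨t₀, ht₀, U, hU, hy, h⟩ := F.exists_connectingPath_mem_lowClassicalPaths hV hr
    exact ⟨U, mem_nhdsWithin_of_mem_nhds (hU.mem_nhds hy), t₀, ht₀,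
      fun z hz ↦ ⟨y, F, U, hU, hz, h⟩⟩

end Globalization

end LowEnergy

end

/-- Let `M` be a compact connected Riemannian manifold and `V` a smooth potential. There are `t₀ > 0`,
an open neighborhood `N` of the diagonal, `μ > 0`, and paths `γ t x y` such that, for `t ∈ (0, t₀)`
and `(x, y) ∈ N`, the path `γ t x y` is the unique element of `Γ^H_{t,x,y}(μ / t)` and the unique
element of `Γ^H_{t,x,y}` with the lowest initial momentum and energy, its action integral exists,
and both the path and the action depend smoothly on all variables. -/
theorem theorem4p2
    {E : Type*} [NormedAddCommGroup E] [NormedSpace ℝ E] [FiniteDimensional ℝ E]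
    {M : Type*} [TopologicalSpace M] [T2Space M] [CompactSpace M] [ConnectedSpace M]
    [ChartedSpace E M] [IsManifold 𝓘(ℝ, E) ∞ M]
    [RiemannianBundle (fun x : M ↦ TangentSpace 𝓘(ℝ, E) x)]
    [IsContMDiffRiemannianBundle 𝓘(ℝ, E) ∞ E (fun x : M ↦ TangentSpace 𝓘(ℝ, E) x)]
    (V : M → ℝ) (hV : ContMDiff 𝓘(ℝ, E) 𝓘(ℝ, ℝ) ∞ V) :
    ∃ (t₀ : ℝ) (N : Set (M × M)) (μ : ℝ), 0 < t₀ ∧ IsOpen N ∧ (∀ x : M, (x, x) ∈ N) ∧ 0 < μ ∧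
      ∃ γ : ℝ → M → M → ℝ → LowEnergy.CotangentBundle E M,
        (∀ t ∈ Ioo (0 : ℝ) t₀, ∀ x y : M, (x, y) ∈ N →
          (γ t x y ∈ LowEnergy.lowClassicalPaths (LowEnergy.hamiltonian V) t x y (μ / t) ∧
            ∀ c ∈ LowEnergy.lowClassicalPaths (LowEnergy.hamiltonian V) t x y (μ / t),
              EqOn c (γ t x y) (Icc 0 t)) ∧
          (∀ c ∈ LowEnergy.classicalPaths (LowEnergy.hamiltonian V) t x y,
            EqOn c (γ t x y) (Icc 0 t) ∨
              (LowEnergy.momentumNorm (γ t x y 0) < LowEnergy.momentumNorm (c 0) ∧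
                LowEnergy.hamiltonian V (γ t x y 0) < LowEnergy.hamiltonian V (c 0))) ∧
          IntervalIntegrable (LowEnergy.lagrangianAlong V t (γ t x y)) volume 0 t) ∧
        ContMDiffOn (𝓘(ℝ, ℝ).prod (𝓘(ℝ, E).prod (𝓘(ℝ, E).prod 𝓘(ℝ, ℝ))))
          (LowEnergy.cotangentModel E) ∞
          (fun p : ℝ × M × M × ℝ ↦ γ p.1 p.2.1 p.2.2.1 p.2.2.2)
          {p | p.1 ∈ Ioo (0 : ℝ) t₀ ∧ (p.2.1, p.2.2.1) ∈ N ∧ p.2.2.2 ∈ Icc (0 : ℝ) p.1} ∧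
        ContMDiffOn (𝓘(ℝ, ℝ).prod (𝓘(ℝ, E).prod 𝓘(ℝ, E))) 𝓘(ℝ, ℝ) ∞
          (fun p : ℝ × M × M ↦ LowEnergy.action V p.1 (γ p.1 p.2.1 p.2.2))
          (Ioo (0 : ℝ) t₀ ×ˢ N) := by
  -- The momentum bound is fixed by uniqueness first; existence then supplies a time for which the
  -- connecting paths obey that same bound.
  obtain ⟨μ, hμ, hunique⟩ := LowEnergy.exists_eqOn_of_mem_lowClassicalPaths hV
  obtain ⟨t₁, ht₁, hex⟩ := LowEnergy.exists_connectingPath_mem_lowClassicalPaths hV hμ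
  choose y₀ F U hU hzU hF using hex
  -- The chart is chosen separately for each pair of endpoints, with no regularity in the pair;
  -- smoothness is recovered from uniqueness.
  have hchart : ∀ a b : M, ∃ z, (a, b) ∈ (⋃ z, U z ×ˢ U z) → (a, b) ∈ U z ×ˢ U z := by
    intro a b
    by_cases h : (a, b) ∈ ⋃ z, U z ×ˢ U z
    · obtain ⟨z, hz⟩ := mem_iUnion.1 h
      exact ⟨z, fun _ ↦ hz⟩
    · exact ⟨a, fun h' ↦ absurd h' h⟩
  choose Z hZ using hchart
  set γ : ℝ → M → M → ℝ → LowEnergy.CotangentBundle E M :=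
    fun t a b ↦ (F (Z a b)).connectingPath t a b
  have hlow : ∀ t ∈ Ioo 0 (min μ t₁), ∀ a b, (a, b) ∈ (⋃ z, U z ×ˢ U z) →
      γ t a b ∈ LowEnergy.lowClassicalPaths (LowEnergy.hamiltonian V) t a b (μ / t) :=
    fun t ht a b hab ↦ (hF (Z a b) t ⟨ht.1, ht.2.trans_le (min_le_right _ _)⟩ a (hZ a b hab).1
      b (hZ a b hab).2).2
  have huniq : ∀ t ∈ Ioo 0 (min μ t₁), ∀ a b, (a, b) ∈ (⋃ z, U z ×ˢ U z) →
      ∀ c ∈ LowEnergy.lowClassicalPaths (LowEnergy.hamiltonian V) t a b (μ / t),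
        EqOn c (γ t a b) (Icc 0 t) :=
    fun t ht a b hab c hc ↦ hunique b t ⟨ht.1, ht.2.trans_le (min_le_left _ _)⟩ a c hc _
      (hlow t ht a b hab)
  have hopen : ∀ z, IsOpen {p : M × M | p ∈ U z ×ˢ U z} := fun z ↦ (hU z).prod (hU z)
  refine ⟨min μ t₁, ⋃ z, U z ×ˢ U z, μ, lt_min hμ ht₁, isOpen_iUnion hopen,
    fun x ↦ mem_iUnion.2 ⟨x, hzU x, hzU x⟩, hμ, γ, fun t ht a b hab ↦
      ⟨⟨hlow t ht a b hab, huniq t ht a b hab⟩, fun c hc ↦ ?_, ?_⟩, ?_, ?_⟩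
  -- A path below the threshold `μ / t` is the low path; any other has momentum at least `μ / t`,
  -- and a common starting point turns this into an energy inequality.
  · by_cases hcl : LowEnergy.momentumNorm (c 0) < μ / t
    · exact Or.inl (huniq t ht a b hab c ⟨hc, hcl⟩)
    · have h1 := hlow t ht a b hab
      have h2 := h1.2.trans_le (not_lt.1 hcl)
      exact Or.inr ⟨h2, LowEnergy.hamiltonian_lt_hamiltonian (h1.1.2.1.trans hc.2.1.symm) h2⟩
  · exact (F (Z a b)).intervalIntegrable_connectingPath hV (hF (Z a b) t
      ⟨ht.1, ht.2.trans_le (min_le_right _ _)⟩ a (hZ a b hab).1 b (hZ a b hab).2).1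
  · refine contMDiffOn_of_locally_contMDiffOn fun p hp ↦ ?_
    obtain ⟨z, hz⟩ := mem_iUnion.1 hp.2.1
    refine ⟨{p | (p.2.1, p.2.2.1) ∈ U z ×ˢ U z}, (hopen z).preimage (by fun_prop), hz, ?_⟩
    -- On `U z ×ˢ U z` the chosen path agrees on `[0, t]` with the one from the fixed flow `F z`,
    -- whose smoothness is known.
    refine ((F z).contMDiffOn_connectingPath.mono ?_).congr ?_
    · rintro ⟨t, a, b, s⟩ ⟨⟨ht, -, hs⟩, hab⟩
      exact ⟨(hF z t ⟨ht.1, ht.2.trans_le (min_le_right _ _)⟩ a hab.1 b hab.2).1, hs⟩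
    · rintro ⟨t, a, b, s⟩ ⟨⟨ht, hN, hs⟩, hab⟩
      exact (huniq t ht a b hN _
        (hF z t ⟨ht.1, ht.2.trans_le (min_le_right _ _)⟩ a hab.1 b hab.2).2 hs).symm
  · refine contMDiffOn_of_locally_contMDiffOn fun p hp ↦ ?_
    obtain ⟨z, hz⟩ := mem_iUnion.1 hp.2
    refine ⟨{p | p.2 ∈ U z ×ˢ U z}, (hopen z).preimage (by fun_prop), hz, ?_⟩
    refine (((F z).contMDiffOn_action_connectingPath hV).mono ?_).congr ?_
    · rintro ⟨t, a, b⟩ ⟨⟨ht, -⟩, hab⟩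
      exact (hF z t ⟨ht.1, ht.2.trans_le (min_le_right _ _)⟩ a hab.1 b hab.2).1
    · rintro ⟨t, a, b⟩ ⟨⟨ht, hN⟩, hab⟩
      have h1 := (hF z t ⟨ht.1, ht.2.trans_le (min_le_right _ _)⟩ a hab.1 b hab.2).2
      exact LowEnergy.action_congr hV ht.1 (hlow t ht a b hN).1.1 h1.1.1
        (huniq t ht a b hN _ h1).symm
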